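/- Theorem 1.2. Let $n$ be a natural number and let $X_1,\dots,X_n$ be independent random variables, defined on a common probability space, with values in a Polish space $\mathcal X$. Let $\mathcal S$ be a nonempty countable class of measurable functions $s=(s^1,\dots,s^n)$ from $\mathcal X$ into $[-1,1]^n$ such that $\mathbb E(s^k(X_k))=0$ for every $s\in\mathcal S$ and every $1\le k\le n$. Set $$S_n(s)=\sum_{k=1}^n s^k(X_k),\qquad Z=\sup_{s\in\mathcal S}S_n(s),\qquad V_n=\sup_{s\in\mathcal S}\operatorname{Var}S_n(s),\qquad v=2\,\mathbb E(Z)+V_n,$$ and let $L(t)=\log\mathbb E(\exp(tZ))$ for real $t$. Then: (a) for every $t>0$, $$L(-t)\le -t\,\mathbb E(Z)+\frac v9\left(e^{3t}-3t-1\right);$$ (b) for every $x>0$, $$\mathbb P(Z\le\mathbb E(Z)-x)\le\exp\left(-\frac v9\,h\left(\frac{3x}{v}\right)\right),\qquad h(u)=(1+u)\log(1+u)-u,$$ where for $v=0$ the right-hand side is read as its limit $0$ as $v\downarrow0$; (c) for every $x>0$, $$\mathbb P(Z\le\mathbb E(Z)-x)\le\exp\left(-\frac{x^2}{v+\sqrt{v^2+2vx}+x}\right)\le\exp\left(-\frac{x^2}{2v+2x}\right).$$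 -/

import Mathlib

open MeasureTheory ProbabilityTheory

noncomputable section

namespace KleinRio

variable {Ω E : Type*} {n : ℕ}

/-- The sum `S_n(s) = s^1(X_1) + ... + s^n(X_n)` for `s = (s^1, ..., s^n) : E → ℝ^n`. -/
def partialSum (X : Fin n → Ω → E) (s : E → Fin n → ℝ) (ω : Ω) : ℝ :=
  ∑ k, s (X k ω) k

/-- `Z = sup {S_n(s) : s ∈ S}`. The supremum is finite when `S` is nonempty with values in
`[-1, 1]^n`. -/
def supProcess (X : Fin n → Ω → E) (S : Set (E → Fin n → ℝ)) (ω : Ω) : ℝ :=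
  ⨆ s : S, partialSum X s.1 ω

/-- The maximal variance `V_n = sup {Var S_n(s) : s ∈ S}`. -/
def maxVariance [MeasurableSpace Ω] (μ : Measure Ω) (X : Fin n → Ω → E)
    (S : Set (E → Fin n → ℝ)) : ℝ :=
  ⨆ s : S, variance (partialSum X s.1) μ

/-- The variance factor `v = 2 E(Z) + V_n`. -/
def varianceFactor [MeasurableSpace Ω] (μ : Measure Ω) (X : Fin n → Ω → E)
    (S : Set (E → Fin n → ℝ)) : ℝ :=
  2 * (∫ ω, supProcess X S ω ∂μ) + maxVariance μ X S

/-- `h(x) = (1 + x) log(1 + x) - x`. -/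
def bennettH (x : ℝ) : ℝ := (1 + x) * Real.log (1 + x) - x

/-- The Bennett bound `exp(-(v/9) h(3x/v))` for `v ≠ 0`; at `v = 0` it is given its limit `0` as
`v` decreases to `0` (for `x > 0`). -/
def bennettBound (v x : ℝ) : ℝ :=
  if v = 0 then 0 else Real.exp (-(v / 9) * bennettH (3 * x / v))

end KleinRio

end

/-! The proof is the entropy method applied to `exp (-t Z)`, for a maximum of finitely many sums
first. Entropy is subadditive over independent coordinates (`ent_pi_le`), so it suffices to bound
the entropy in one coordinate with the others frozen. There `f = exp (-t Z)` is the minimum over `i`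
of `exp (-t (c i + Y i y))`, with each `Y i` centered and bounded by one.

The crux is `ent_exp_max_le`. The variational formula compares `f` with a single exponential `g ≥
f`, whose entropy is controlled by its variance. The price is proportional to `∫ g - ∫ f`, and is
absorbed by `rate t * ∫ f` times the logarithm of the ratio of the means. Choosing `g` to minimise a
variance-penalised exponent allows that minimum to be compared, at every `y`, with the index
attaining `Z`. The frozen constants then cancel, leaving only the current summand of the maximising
sum and its variance (`one_sub_rate_mul_ent_le`). Summed over coordinates, these rebuild `Z` and at
most `V`.

For `l t = log E exp (-t Z)` this reads `t l' ≤ (1 - rate t) l + (rate t * expRem t + entRem t) V`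
when `0 < t ≤ 2/5`. The desired bound is a supersolution (`target_supersolution`) with the same
value and slope at `0`, so an integrating factor gives the comparison. For `t ≥ 7/10` it is enough
that `Z` dominates one centered sum, to which Bennett's bound applies; convexity of `l` bridges the
gap (`le_target`).

Countable classes follow by dominated convergence along maxima of initial segments, and the tail
bounds by Chernoff's inequality and optimisation in `t`. -/

namespace KleinRio

/-! ### Scalar inequalities for the exponential -/

/-- A function vanishing at `0` with nonnegative derivative on `[0, ∞)` is nonnegative there. -/
theorem nonneg_of_hasDerivAt_nonneg {F F' : ℝ → ℝ} (hF : ∀ x, HasDerivAt F (F' x) x)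
    (h0 : F 0 = 0) (hF' : ∀ x, 0 ≤ x → 0 ≤ F' x) {t : ℝ} (ht : 0 ≤ t) : 0 ≤ F t := by
  have hmono : MonotoneOn F (Set.Ici 0) := by
    refine monotoneOn_of_deriv_nonneg (convex_Ici 0)
      (fun x _ => (hF x).continuousAt.continuousWithinAt)
      (fun x _ => (hF x).differentiableAt.differentiableWithinAt) fun x hx => ?_
    rw [(hF x).deriv]
    rw [interior_Ici] at hx
    exact hF' x (le_of_lt hx)
  have h := hmono (Set.mem_Ici.2 le_rfl) (Set.mem_Ici.2 ht) ht
  rwa [h0] at h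

theorem hasDerivAt_exp_const_mul (a x : ℝ) :
    HasDerivAt (fun t : ℝ => Real.exp (a * t)) (a * Real.exp (a * x)) x := by
  have h : HasDerivAt (fun t : ℝ => Real.exp (a * t)) (Real.exp (a * x) * (a * 1)) x :=
    ((hasDerivAt_id x).const_mul a).exp
  convert! h using 1
  ring

/-- The second-order remainder `exp t - t - 1` of the exponential. -/
noncomputable def expRem (t : ℝ) : ℝ := Real.exp t - t - 1

/-- The entropy remainder `1 + (t - 1) exp t`. -/
noncomputable def entRem (t : ℝ) : ℝ := 1 + (t - 1) * Real.exp t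

/-- The coefficient multiplying the entropy deficit in the differential inequality. -/
noncomputable def rate (t : ℝ) : ℝ := t + 3 * t ^ 2 + t ^ 3

theorem hasDerivAt_expRem (x : ℝ) : HasDerivAt expRem (Real.exp x - 1) x :=
  ((Real.hasDerivAt_exp x).sub (hasDerivAt_id x)).sub_const 1

theorem hasDerivAt_entRem (x : ℝ) : HasDerivAt entRem (x * Real.exp x) x := by
  have h : HasDerivAt entRem (1 * Real.exp x + (x - 1) * Real.exp x) x :=
    (((hasDerivAt_id x).sub_const 1).mul (Real.hasDerivAt_exp x)).const_add 1
  convert! h using 1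
  ring

theorem hasDerivAt_expRem_const_mul (a x : ℝ) :
    HasDerivAt (fun t => expRem (a * t)) (a * (Real.exp (a * x) - 1)) x := by
  have h : HasDerivAt (fun t => expRem (a * t)) ((Real.exp (a * x) - 1) * (a * 1)) x :=
    (hasDerivAt_expRem (a * x)).comp x ((hasDerivAt_id x).const_mul a)
  convert! h using 1
  ring

theorem hasDerivAt_entRem_const_mul (a x : ℝ) :
    HasDerivAt (fun t => entRem (a * t)) (a ^ 2 * (x * Real.exp (a * x))) x := by
  have h : HasDerivAt (fun t => entRem (a * t)) ((a * x * Real.exp (a * x)) * (a * 1)) x :=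
    (hasDerivAt_entRem (a * x)).comp x ((hasDerivAt_id x).const_mul a)
  convert! h using 1
  ring

theorem expRem_zero : expRem 0 = 0 := by simp [expRem]

theorem entRem_zero : entRem 0 = 0 := by simp [entRem]

theorem expRem_nonneg (t : ℝ) : 0 ≤ expRem t := by
  unfold expRem
  linarith [Real.add_one_le_exp t]

theorem entRem_nonneg {t : ℝ} (ht : 0 ≤ t) : 0 ≤ entRem t :=
  nonneg_of_hasDerivAt_nonneg hasDerivAt_entRem entRem_zero
    (fun x hx => mul_nonneg hx (Real.exp_pos x).le) ht

theorem rate_pos {t : ℝ} (ht : 0 < t) : 0 < rate t := by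
  unfold rate
  positivity

theorem exp_mul_le_exp {u x : ℝ} (hu : u ≤ 1) (hx : 0 ≤ x) : Real.exp (u * x) ≤ Real.exp x :=
  Real.exp_le_exp.2 (by nlinarith)

theorem mul_exp_mul_sub_one_le {u t : ℝ} (hu : |u| ≤ 1) (ht : 0 ≤ t) :
    u * (Real.exp (u * t) - 1) ≤ u ^ 2 * (Real.exp t - 1) := by
  have h := nonneg_of_hasDerivAt_nonneg
    (F := fun t => u ^ 2 * (Real.exp t - 1) - u * (Real.exp (u * t) - 1))
    (F' := fun t => u ^ 2 * Real.exp t - u * (u * Real.exp (u * t)))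
    (fun x => (((Real.hasDerivAt_exp x).sub_const 1).const_mul _).sub
      (((hasDerivAt_exp_const_mul u x).sub_const 1).const_mul _)) (by simp)
    (fun x hx => by
      have := mul_le_mul_of_nonneg_left (exp_mul_le_exp (abs_le.1 hu).2 hx) (sq_nonneg u)
      linarith) ht
  linarith

/-- For `|u| ≤ 1`, `exp (u t) - u t - 1 ≤ u ^ 2 (exp t - t - 1)`. -/
theorem expRem_mul_le {u t : ℝ} (hu : |u| ≤ 1) (ht : 0 ≤ t) :
    expRem (u * t) ≤ u ^ 2 * expRem t := by
  have h := nonneg_of_hasDerivAt_nonneg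
    (F := fun t => u ^ 2 * expRem t - expRem (u * t))
    (F' := fun t => u ^ 2 * (Real.exp t - 1) - u * (Real.exp (u * t) - 1))
    (fun x => ((hasDerivAt_expRem x).const_mul _).sub (hasDerivAt_expRem_const_mul u x))
    (by simp [expRem_zero])
    (fun x hx => by linarith [mul_exp_mul_sub_one_le hu hx]) ht
  linarith

theorem entRem_mul_le {u t : ℝ} (hu : |u| ≤ 1) (ht : 0 ≤ t) :
    entRem (u * t) ≤ u ^ 2 * entRem t := by
  have h := nonneg_of_hasDerivAt_nonneg
    (F := fun t => u ^ 2 * entRem t - entRem (u * t))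
    (F' := fun t => u ^ 2 * (t * Real.exp t) - u ^ 2 * (t * Real.exp (u * t)))
    (fun x => ((hasDerivAt_entRem x).const_mul _).sub (hasDerivAt_entRem_const_mul u x))
    (by simp [entRem_zero])
    (fun x hx => by
      have := mul_le_mul_of_nonneg_left
        (mul_le_mul_of_nonneg_left (exp_mul_le_exp (abs_le.1 hu).2 hx) hx) (sq_nonneg u)
      linarith) ht
  linarith

theorem nine_mul_expRem_le {t : ℝ} (ht : 0 ≤ t) : 9 * expRem t ≤ expRem (3 * t) := by
  have h := nonneg_of_hasDerivAt_nonneg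
    (F := fun t => expRem (3 * t) - 9 * expRem t)
    (F' := fun t => 3 * (Real.exp (3 * t) - 1) - 9 * (Real.exp t - 1))
    (fun x => (hasDerivAt_expRem_const_mul 3 x).sub ((hasDerivAt_expRem x).const_mul 9))
    (by simp [expRem_zero])
    (fun x hx => by
      have h3 : Real.exp (3 * x) = Real.exp x ^ 3 := by
        rw [← Real.exp_nat_mul]
        norm_num
      have hp := Real.exp_pos x
      rw [h3]
      -- With `e = exp x`, the derivative is `3 (e ^ 3 - 3 e + 2) = 3 (e - 1) ^ 2 (e + 2)`.
      nlinarith [mul_nonneg (sq_nonneg (Real.exp x - 1)) (by linarith : 0 ≤ Real.exp x + 2)]) ht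
  linarith

/-- The difference has derivative `t (exp (3 t) - exp t)`. This supplies the coefficient of `V` in
`target_supersolution`. -/
theorem entRem_le_mul_exp_sub {t : ℝ} (ht : 0 ≤ t) :
    entRem t ≤ t * (Real.exp (3 * t) - 1) / 3 - expRem (3 * t) / 9 := by
  have h := nonneg_of_hasDerivAt_nonneg
    (F := fun t => t * (Real.exp (3 * t) - 1) / 3 - expRem (3 * t) / 9 - entRem t)
    (F' := fun t => (1 * (Real.exp (3 * t) - 1) + t * (3 * Real.exp (3 * t))) / 3
      - 3 * (Real.exp (3 * t) - 1) / 9 - t * Real.exp t)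
    (fun x => ((((hasDerivAt_id x).mul ((hasDerivAt_exp_const_mul 3 x).sub_const 1)).div_const
      3).sub ((hasDerivAt_expRem_const_mul 3 x).div_const 9)).sub (hasDerivAt_entRem x))
    (by simp [expRem_zero, entRem_zero])
    (fun x hx => by
      have := mul_le_mul_of_nonneg_left
        (Real.exp_le_exp.2 (by linarith : x ≤ 3 * x)) hx
      linarith) ht
  linarith

theorem sq_add_cube_le_expRem {t : ℝ} (ht : 0 ≤ t) :
    t ^ 2 + t ^ 3 ≤ 2 / 9 * expRem (3 * t) := by
  have h := Real.sum_le_exp_of_nonneg (by linarith : 0 ≤ 3 * t) 4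
  simp only [Finset.sum_range_succ, Finset.sum_range_zero, Nat.factorial] at h
  norm_num at h
  unfold expRem
  nlinarith

/-- The difference has derivative `2 t (exp (3 t) - 1 - 3 t)`. This supplies the coefficient of `z`
in `target_supersolution`, since `t ^ 2 + 2 t ^ 3` dominates `rate t * (t - t ^ 2)`. -/
theorem sq_add_two_cube_le {t : ℝ} (ht : 0 ≤ t) :
    t ^ 2 + 2 * t ^ 3 ≤ 2 / 3 * (t * (Real.exp (3 * t) - 1)) - 2 / 9 * expRem (3 * t) := by
  have h := nonneg_of_hasDerivAt_nonneg
    (F := fun t => 2 / 3 * (t * (Real.exp (3 * t) - 1)) - 2 / 9 * expRem (3 * t)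
      - (t ^ 2 + 2 * t ^ 3))
    (F' := fun t => 2 / 3 * (1 * (Real.exp (3 * t) - 1) + t * (3 * Real.exp (3 * t)))
      - 2 / 9 * (3 * (Real.exp (3 * t) - 1))
      - ((2 : ℕ) * t ^ (2 - 1) + 2 * ((3 : ℕ) * t ^ (3 - 1))))
    (fun x => ((((hasDerivAt_id x).mul ((hasDerivAt_exp_const_mul 3 x).sub_const 1)).const_mul
      (2 / 3)).sub ((hasDerivAt_expRem_const_mul 3 x).const_mul (2 / 9))).sub
      ((hasDerivAt_pow 2 x).add ((hasDerivAt_pow 3 x).const_mul 2)))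
    (by simp [expRem_zero])
    (fun x hx => by
      have := mul_le_mul_of_nonneg_left (Real.add_one_le_exp (3 * x)) hx
      norm_num
      nlinarith) ht
  linarith

theorem exp_le_cubic {x : ℝ} (h0 : 0 ≤ x) (h1 : x ≤ 1) :
    Real.exp x ≤ 1 + x + x ^ 2 / 2 + 2 / 9 * x ^ 3 := by
  -- The remainder after three terms is at most `x ^ 3 * 4 / (3! * 3)`, whence `2 / 9`.
  have h := Real.exp_bound' h0 h1 (n := 3) (by norm_num)
  simp only [Finset.sum_range_succ, Finset.sum_range_zero, Nat.factorial] at h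
  norm_num at h
  linarith

theorem entRem_le_rate_mul {t : ℝ} (h0 : 0 ≤ t) (h1 : t ≤ 2 / 5) :
    entRem t ≤ t / 2 * rate t := by
  have h := nonneg_of_hasDerivAt_nonneg
    (F := fun t => t ^ 2 * Real.exp t / 2 - entRem t)
    (F' := fun t => (((2 : ℕ) * t ^ (2 - 1)) * Real.exp t + t ^ 2 * Real.exp t) / 2
      - t * Real.exp t)
    (fun x => (((hasDerivAt_pow 2 x).mul (Real.hasDerivAt_exp x)).div_const 2).sub
      (hasDerivAt_entRem x)) (by simp [entRem_zero])
    (fun x hx => by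
      have := mul_nonneg (sq_nonneg x) (Real.exp_pos x).le
      norm_num
      linarith) h0
  have he := exp_le_cubic h0 (by linarith)
  have h2 : Real.exp t ≤ 1 + 3 * t + t ^ 2 := by nlinarith [pow_nonneg h0 3]
  have := mul_le_mul_of_nonneg_left h2 (sq_nonneg t)
  unfold rate
  nlinarith

/-- Used with `b` the logarithm of a ratio of means: it trades a difference of means for a
difference of logarithms, and is the main demand that `rate` be large enough. -/
theorem exp_sub_one_mul_le_rate_mul {t b : ℝ} (ht0 : 0 ≤ t) (ht1 : t ≤ 2 / 5) (hb0 : 0 ≤ b)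
    (hb : b ≤ Real.exp t - 1 + t / 2) :
    (Real.exp b - 1) * (t * Real.exp t) ≤ rate t * b := by
  have he := exp_le_cubic ht0 (by linarith)
  have he' : Real.exp t ≤ 1 + t + 3 / 5 * t ^ 2 := by nlinarith [sq_nonneg t]
  -- Since `t ≤ 2/5`, `3/2 t + 3/5 t ^ 2 ≤ (3/2 + 6/25) t = 87/50 t`.
  have hb' : b ≤ 87 / 50 * t := by nlinarith
  have heb := exp_le_cubic hb0 (by linarith)
  have heb' : Real.exp b - 1 ≤ b * (1 + 57 / 50 * t) := by
    have h1 : b ^ 2 / 2 + 2 / 9 * b ^ 3 ≤ b * (57 / 50 * t) := by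
      have : b / 2 + 2 / 9 * b ^ 2 ≤ 57 / 50 * t := by nlinarith
      nlinarith
    linarith
  calc (Real.exp b - 1) * (t * Real.exp t)
      ≤ (b * (1 + 57 / 50 * t)) * (t * (1 + t + 3 / 5 * t ^ 2)) := by
        refine mul_le_mul heb' (mul_le_mul_of_nonneg_left he' ht0)
          (mul_nonneg ht0 (Real.exp_pos t).le) (by positivity)
    _ = b * t * ((1 + 57 / 50 * t) * (1 + t + 3 / 5 * t ^ 2)) := by ring
    _ ≤ b * t * (1 + 3 * t + t ^ 2) := by
        refine mul_le_mul_of_nonneg_left ?_ (by positivity)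
        nlinarith [mul_nonneg ht0 (sub_nonneg.2 ht1), mul_nonneg (sq_nonneg t) (sub_nonneg.2 ht1)]
    _ = rate t * b := by unfold rate; ring

theorem rate_le_one {t : ℝ} (h0 : 0 ≤ t) (h1 : t ≤ 2 / 5) : rate t ≤ 1 := by
  have h2 : t ^ 2 ≤ (2 / 5) ^ 2 := pow_le_pow_left₀ h0 h1 2
  have h3 : t ^ 3 ≤ (2 / 5) ^ 3 := pow_le_pow_left₀ h0 h1 3
  unfold rate
  linarith

/-- The target bound `-t z + v / 9 * (exp (3 t) - 3 t - 1)` with `v = 2 z + V` is a supersolution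
of the differential inequality satisfied by the log-Laplace transform. -/
theorem target_supersolution {t z V : ℝ} (ht : 0 ≤ t) (hz : 0 ≤ z) (hV : 0 ≤ V) :
    (1 - rate t) * (-t * z + (2 * z + V) / 9 * expRem (3 * t))
        + (rate t * expRem t + entRem t) * V
      ≤ t * (-z + (2 * z + V) / 9 * (3 * (Real.exp (3 * t) - 1))) := by
  have hr : 0 ≤ rate t := by unfold rate; positivity
  have hA : 0 ≤ 2 / 3 * (t * (Real.exp (3 * t) - 1)) - 2 / 9 * expRem (3 * t)
      - rate t * (t - 2 / 9 * expRem (3 * t)) := by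
    have h1 := sq_add_two_cube_le ht
    have h2 : rate t * (t - 2 / 9 * expRem (3 * t)) ≤ rate t * (t - t ^ 2) :=
      mul_le_mul_of_nonneg_left (by linarith [sq_add_cube_le_expRem ht, pow_nonneg ht 3]) hr
    have h3 : rate t * (t - t ^ 2) = t ^ 2 + 2 * t ^ 3 - (2 * t ^ 4 + t ^ 5) := by
      unfold rate; ring
    have h4 : 0 ≤ 2 * t ^ 4 + t ^ 5 := by positivity
    linarith
  have hB : 0 ≤ t * (Real.exp (3 * t) - 1) / 3 - expRem (3 * t) / 9 - entRem t
      + rate t * (expRem (3 * t) / 9 - expRem t) := by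
    have h1 := entRem_le_mul_exp_sub ht
    have h2 : 0 ≤ rate t * (expRem (3 * t) / 9 - expRem t) :=
      mul_nonneg hr (by linarith [nine_mul_expRem_le ht])
    linarith
  nlinarith [mul_nonneg hz hA, mul_nonneg hV hB]

/-! ### Entropy and its subadditivity -/

/-- Measurable functions with values in a compact subinterval of `(0, ∞)`. -/
def IsBddPos {α : Type*} [MeasurableSpace α] (f : α → ℝ) : Prop :=
  Measurable f ∧ ∃ a b : ℝ, 0 < a ∧ ∀ x, a ≤ f x ∧ f x ≤ b

/-- The entropy functional `∫ f log f - (∫ f) log (∫ f)`. -/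
noncomputable def ent {α : Type*} [MeasurableSpace α] (ν : Measure α) (f : α → ℝ) : ℝ :=
  ∫ x, f x * Real.log (f x) ∂ν - (∫ x, f x ∂ν) * Real.log (∫ x, f x ∂ν)

theorem integrable_of_abs_le {α : Type*} [MeasurableSpace α] {ν : Measure α} [IsFiniteMeasure ν]
    {f : α → ℝ} (hf : Measurable f) {C : ℝ} (hC : ∀ x, |f x| ≤ C) : Integrable f ν :=
  Integrable.of_bound hf.aestronglyMeasurable C (Filter.Eventually.of_forall hC)

namespace IsBddPos

variable {α β : Type*} [MeasurableSpace α] [MeasurableSpace β] {f g : α → ℝ}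

theorem pos (hf : IsBddPos f) (x : α) : 0 < f x := by
  obtain ⟨-, a, b, ha, h⟩ := hf
  exact ha.trans_le (h x).1

theorem exists_abs_le (hf : IsBddPos f) : ∃ C, 0 ≤ C ∧ ∀ x, |f x| ≤ C := by
  obtain ⟨-, a, b, ha, h⟩ := hf
  refine ⟨|b|, abs_nonneg b, fun x => ?_⟩
  rw [abs_of_pos (ha.trans_le (h x).1)]
  exact (h x).2.trans (le_abs_self b)

theorem exists_abs_log_le (hf : IsBddPos f) : ∃ C, 0 ≤ C ∧ ∀ x, |Real.log (f x)| ≤ C := by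
  obtain ⟨-, a, b, ha, h⟩ := hf
  refine ⟨max |Real.log a| |Real.log b|, le_max_of_le_left (abs_nonneg _), fun x => ?_⟩
  exact abs_le_max_abs_abs (Real.log_le_log ha (h x).1)
    (Real.log_le_log (ha.trans_le (h x).1) (h x).2)

theorem integrable (hf : IsBddPos f) (ν : Measure α) [IsFiniteMeasure ν] : Integrable f ν := by
  obtain ⟨C, -, hC⟩ := hf.exists_abs_le
  exact integrable_of_abs_le hf.1 hC

theorem integrable_mul_log (hg : IsBddPos g) (hf : IsBddPos f) (ν : Measure α)
    [IsFiniteMeasure ν] : Integrable (fun x => g x * Real.log (f x)) ν := by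
  obtain ⟨C, hC0, hC⟩ := hg.exists_abs_le
  obtain ⟨D, hD0, hD⟩ := hf.exists_abs_log_le
  refine integrable_of_abs_le (hg.1.mul hf.1.log) (C := C * D) fun x => ?_
  rw [abs_mul]
  exact mul_le_mul (hC x) (hD x) (abs_nonneg _) hC0

theorem comp (hf : IsBddPos f) {φ : β → α} (hφ : Measurable φ) : IsBddPos fun x => f (φ x) := by
  obtain ⟨hm, a, b, ha, h⟩ := hf
  exact ⟨hm.comp hφ, a, b, ha, fun x => h (φ x)⟩

theorem integral_mem (hf : IsBddPos f) :
    ∃ a b : ℝ, 0 < a ∧ ∀ (ν : Measure α) [IsProbabilityMeasure ν],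
      a ≤ ∫ x, f x ∂ν ∧ ∫ x, f x ∂ν ≤ b := by
  obtain ⟨a, b, ha, h⟩ := hf.2
  refine ⟨a, b, ha, fun ν _ => ⟨?_, ?_⟩⟩
  · simpa using integral_mono (μ := ν) (integrable_const a) (hf.integrable ν) fun x => (h x).1
  · simpa using integral_mono (μ := ν) (hf.integrable ν) (integrable_const b) fun x => (h x).2

theorem integral_pos (hf : IsBddPos f) (ν : Measure α) [IsProbabilityMeasure ν] :
    0 < ∫ x, f x ∂ν := by
  obtain ⟨a, b, ha, h⟩ := hf.integral_mem
  exact ha.trans_le (h ν).1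

theorem integral_right {f : α × β → ℝ} (hf : IsBddPos f) (ν : Measure β)
    [IsProbabilityMeasure ν] : IsBddPos fun x => ∫ y, f (x, y) ∂ν := by
  obtain ⟨a, b, ha, h⟩ := hf.2
  refine ⟨hf.1.stronglyMeasurable.integral_prod_right'.measurable, a, b, ha, fun x => ⟨?_, ?_⟩⟩
  · simpa using integral_mono (μ := ν) (integrable_const a)
      ((hf.comp measurable_prodMk_left).integrable ν) fun y => (h (x, y)).1
  · simpa using integral_mono (μ := ν) ((hf.comp measurable_prodMk_left).integrable ν)
      (integrable_const b) fun y => (h (x, y)).2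

theorem integrable_ent {f : α × β → ℝ} (hf : IsBddPos f) (μ : Measure α) (ν : Measure β)
    [IsProbabilityMeasure μ] [IsProbabilityMeasure ν] :
    Integrable (fun x => ent ν fun y => f (x, y)) μ :=
  Integrable.sub (hf.integrable_mul_log hf (μ.prod ν)).integral_prod_left
    ((hf.integral_right ν).integrable_mul_log (hf.integral_right ν) μ)

end IsBddPos

section

variable {α β : Type*} [MeasurableSpace α] [MeasurableSpace β]

/-- The variational lower bound for the entropy. -/
theorem integral_mul_log_sub_le_ent {f g : α → ℝ} (hf : IsBddPos f) (hg : IsBddPos g)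
    (ν : Measure α) [IsProbabilityMeasure ν] :
    ∫ x, g x * Real.log (f x) ∂ν - (∫ x, g x ∂ν) * Real.log (∫ x, f x ∂ν) ≤ ent ν g := by
  set F := ∫ x, f x ∂ν with hF
  set G := ∫ x, g x ∂ν with hG
  have hF0 : 0 < F := hf.integral_pos ν
  have hG0 : 0 < G := hg.integral_pos ν
  have hpt : ∀ x, g x * Real.log (f x) - g x * Real.log F
      ≤ g x * Real.log (g x) - g x * Real.log G + (G / F * f x - g x) := fun x => by
    have hfx := hf.pos x
    have hgx := hg.pos x
    -- Nonnegativity of relative entropy between the normalised `g / G` and `f / F`, proved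
    -- pointwise from `log r ≤ r - 1`; the excess `G / F * f - g` integrates to zero.
    have h1 := Real.log_le_sub_one_of_pos (x := G / F * f x / g x) (by positivity)
    rw [Real.log_div (by positivity) hgx.ne', Real.log_mul (by positivity) hfx.ne',
      Real.log_div hG0.ne' hF0.ne'] at h1
    have h2 := mul_le_mul_of_nonneg_left h1 hgx.le
    have h3 : g x * (G / F * f x / g x - 1) = G / F * f x - g x := by field_simp
    rw [h3] at h2
    linarith
  have hif := hf.integrable ν
  have hig := hg.integrable ν
  have hgf := hg.integrable_mul_log hf ν
  have hgg := hg.integrable_mul_log hg ν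
  have h := integral_mono (hgf.sub (hig.mul_const (Real.log F)))
    ((hgg.sub (hig.mul_const (Real.log G))).add ((hif.const_mul (G / F)).sub hig)) hpt
  have hl : ∫ x, (g x * Real.log (f x) - g x * Real.log F) ∂ν
      = ∫ x, g x * Real.log (f x) ∂ν - G * Real.log F := by
    rw [integral_sub hgf (hig.mul_const _), integral_mul_const]
  have hr : ∫ x, (g x * Real.log (g x) - g x * Real.log G + (G / F * f x - g x)) ∂ν
      = ∫ x, g x * Real.log (g x) ∂ν - G * Real.log G := by
    rw [integral_add (f := fun x => g x * Real.log (g x) - g x * Real.log G)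
      (g := fun x => G / F * f x - g x) (hgg.sub (hig.mul_const _)) ((hif.const_mul _).sub hig),
      integral_sub hgg (hig.mul_const _), integral_sub (hif.const_mul _) hig,
      integral_mul_const, integral_const_mul, ← hF, ← hG, div_mul_cancel₀ _ hF0.ne']
    ring
  have h' := hl.symm.trans_le (h.trans_eq hr)
  unfold ent
  rw [← hG]
  exact h'

/-- The entropy splits exactly as the mean entropy of the `x`-slices plus the entropy of the
marginal `F`. The latter is at most the mean entropy of the `y`-slices: test each of them against
`F` in the variational bound and integrate over `x`. -/
theorem ent_prod_le {f : α × β → ℝ} (hf : IsBddPos f) (μ : Measure α) (ν : Measure β)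
    [IsProbabilityMeasure μ] [IsProbabilityMeasure ν] :
    ent (μ.prod ν) f ≤ ∫ y, ent μ (fun x => f (x, y)) ∂ν + ∫ x, ent ν (fun y => f (x, y)) ∂μ := by
  have hs : IsBddPos fun p : β × α => f (p.2, p.1) := hf.comp measurable_swap
  set F : β → ℝ := fun y => ∫ x, f (x, y) ∂μ with hF
  have hFb : IsBddPos F := hs.integral_right μ
  have hFp : IsBddPos fun p : α × β => F p.2 := hFb.comp measurable_snd
  have hff := hf.integrable_mul_log hf (μ.prod ν)
  have hfF := hf.integrable_mul_log hFp (μ.prod ν)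
  have hfi := hf.integrable (μ.prod ν)
  have hint : ∫ p, f p ∂(μ.prod ν) = ∫ y, F y ∂ν := integral_prod_symm f hfi
  have hfF' : ∫ p, f p * Real.log (F p.2) ∂(μ.prod ν) = ∫ y, F y * Real.log (F y) ∂ν := by
    rw [integral_prod_symm _ hfF]
    simp_rw [integral_mul_const]
    rfl
  have h1 : ∫ y, ent μ (fun x => f (x, y)) ∂ν
      = ∫ p, f p * Real.log (f p) ∂(μ.prod ν) - ∫ y, F y * Real.log (F y) ∂ν := by
    unfold ent
    rw [integral_sub hff.integral_prod_right (hFb.integrable_mul_log hFb ν),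
      integral_prod_symm _ hff]
  have h2 : ∫ y, F y * Real.log (F y) ∂ν - (∫ y, F y ∂ν) * Real.log (∫ y, F y ∂ν)
      ≤ ∫ x, ent ν (fun y => f (x, y)) ∂μ := by
    rw [← hfF', ← hint, integral_prod _ hfF]
    nth_rewrite 1 [integral_prod _ hfi]
    rw [hint, ← integral_mul_const, ← integral_sub hfF.integral_prod_left
      (hfi.integral_prod_left.mul_const _)]
    refine integral_mono (hfF.integral_prod_left.sub (hfi.integral_prod_left.mul_const _))
      (hf.integrable_ent μ ν) fun x => ?_
    exact integral_mul_log_sub_le_ent hFb (hf.comp measurable_prodMk_left) ν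
  rw [h1]
  unfold ent at h2 ⊢
  rw [hint]
  linarith

end

theorem measurable_update_prod {E : Type*} [MeasurableSpace E] {n : ℕ} (k : Fin n) :
    Measurable fun p : (Fin n → E) × E => Function.update p.1 k p.2 :=
  measurable_pi_iff.2 fun j => by
    by_cases h : j = k
    · subst h
      simpa using measurable_snd
    · simp only [Function.update_of_ne h]
      exact (measurable_pi_apply j).comp measurable_fst

theorem integrable_ent_update {E : Type*} [MeasurableSpace E] {n : ℕ} {f : (Fin n → E) → ℝ}
    (hf : IsBddPos f) (μ : Measure (Fin n → E)) [IsProbabilityMeasure μ] (ν : Measure E)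
    [IsProbabilityMeasure ν] (k : Fin n) :
    Integrable (fun x => ent ν fun y => f (Function.update x k y)) μ :=
  (hf.comp (measurable_update_prod k)).integrable_ent μ ν

/-- Subadditivity of the entropy for product measures. -/
theorem ent_pi_le {E : Type*} [MeasurableSpace E] : ∀ {n : ℕ} (μ : Fin n → Measure E)
    [∀ k, IsProbabilityMeasure (μ k)] {f : (Fin n → E) → ℝ}, IsBddPos f →
    ent (Measure.pi μ) f
      ≤ ∑ k, ∫ x, ent (μ k) (fun y => f (Function.update x k y)) ∂(Measure.pi μ)
  | 0, μ, _, f, hf => by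
    have h : ∀ x, f x = f default := fun x => congrArg f (Subsingleton.elim _ _)
    have hc : f = fun _ => f default := funext h
    rw [hc]
    simp [ent]
  | n + 1, μ, _, f, hf => by
    have hmp := (measurePreserving_piFinSuccAbove μ 0).symm
    set e := (MeasurableEquiv.piFinSuccAbove (fun _ : Fin (n + 1) => E) 0).symm with he
    have hcons : ∀ p : E × (Fin n → E), e p = Fin.cons p.1 p.2 := fun p => by
      simp [he, MeasurableEquiv.piFinSuccAbove, Fin.insertNthEquiv]
    have hint : ∀ F : (Fin (n + 1) → E) → ℝ, ∫ x, F x ∂(Measure.pi μ)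
        = ∫ p, F (e p) ∂((μ 0).prod (Measure.pi fun j : Fin n => μ j.succ)) := fun F =>
      (hmp.integral_comp' F).symm
    set P := Measure.pi fun j : Fin n => μ j.succ with hP
    have hfe : IsBddPos fun p => f (e p) := hf.comp e.measurable
    have hent : ent (Measure.pi μ) f = ent ((μ 0).prod P) fun p => f (e p) := by
      unfold ent
      rw [hint, hint]
    rw [hent]
    refine (ent_prod_le hfe (μ 0) P).trans ?_
    rw [Fin.sum_univ_succ]
    refine add_le_add (le_of_eq ?_) ?_
    -- Resampling the first coordinate erases its old value, so averaging over that value changes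
    -- nothing.
    · rw [hint, integral_prod_symm]
      · simp only [hcons, Fin.update_cons_zero, integral_const, probReal_univ, one_smul]
      · have := integrable_ent_update hf (Measure.pi μ) (μ 0) 0
        exact hmp.integrable_comp_of_integrable this
    · have hstep : ∀ x : E, ent P (fun y => f (e (x, y)))
          ≤ ∑ k, ∫ y, ent (μ (Fin.succ k)) (fun z => f (e (x, Function.update y k z))) ∂P :=
        fun x => ent_pi_le (fun j : Fin n => μ j.succ) (hfe.comp measurable_prodMk_left)
      have hik : ∀ k : Fin n, Integrable (fun p : E × (Fin n → E) =>
          ent (μ k.succ) (fun z => f (e (p.1, Function.update p.2 k z)))) ((μ 0).prod P) :=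
        fun k => by
          have h1 := hmp.integrable_comp_of_integrable
            (integrable_ent_update hf (Measure.pi μ) (μ k.succ) k.succ)
          refine h1.congr (Filter.Eventually.of_forall fun p => ?_)
          simp only [Function.comp, hcons, Fin.cons_update]
      refine (integral_mono (hfe.integrable_ent (μ 0) P)
        (integrable_finsetSum _ fun k _ => (hik k).integral_prod_left) hstep).trans
        (le_of_eq ?_)
      rw [integral_finsetSum _ fun k _ => (hik k).integral_prod_left]
      refine Finset.sum_congr rfl fun k _ => ?_
      rw [← integral_prod _ (hik k), hint]
      simp only [hcons, Fin.cons_update]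

/-! ### Laplace transform and entropy of one centered bounded variable -/

theorem integral_sq_nonneg {E : Type*} [MeasurableSpace E] {ν : Measure E} {Y : E → ℝ} :
    0 ≤ ∫ y, Y y ^ 2 ∂ν := integral_nonneg fun y => sq_nonneg (Y y)

section

variable {E : Type*} [MeasurableSpace E] {ν : Measure E} [IsProbabilityMeasure ν] {Y : E → ℝ}

theorem isBddPos_exp {α : Type*} [MeasurableSpace α] {g : α → ℝ} (hg : Measurable g) {C : ℝ}
    (hC : ∀ x, |g x| ≤ C) : IsBddPos fun x => Real.exp (g x) :=
  ⟨hg.exp, Real.exp (-C), Real.exp C, Real.exp_pos _, fun x =>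
    ⟨Real.exp_le_exp.2 (abs_le.1 (hC x)).1, Real.exp_le_exp.2 (abs_le.1 (hC x)).2⟩⟩

theorem isBddPos_exp_mul (hY : Measurable Y) (hb : ∀ y, |Y y| ≤ 1) (c t : ℝ) :
    IsBddPos fun y => Real.exp (-t * (c + Y y)) := by
  refine isBddPos_exp ((hY.const_add c).const_mul (-t)) (C := |t| * (|c| + 1)) fun y => ?_
  rw [abs_mul, abs_neg]
  exact mul_le_mul_of_nonneg_left ((abs_add_le _ _).trans (by linarith [hb y])) (abs_nonneg t)

theorem integrable_of_abs_le_one (hY : Measurable Y) (hb : ∀ y, |Y y| ≤ 1) : Integrable Y ν :=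
  integrable_of_abs_le hY hb

theorem integrable_sq_of_abs_le_one (hY : Measurable Y) (hb : ∀ y, |Y y| ≤ 1) :
    Integrable (fun y => Y y ^ 2) ν :=
  integrable_of_abs_le (hY.pow_const 2) (C := 1) fun y => by
    rw [abs_pow]
    exact pow_le_one₀ (abs_nonneg _) (hb y)

theorem integral_sq_le_one (hY : Measurable Y) (hb : ∀ y, |Y y| ≤ 1) :
    ∫ y, Y y ^ 2 ∂ν ≤ 1 := by
  have h := integral_mono (μ := ν) (integrable_sq_of_abs_le_one hY hb) (integrable_const (1 : ℝ))
    fun y => by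
      rw [← sq_abs]
      exact pow_le_one₀ (abs_nonneg _) (hb y)
  simpa using h

theorem integrable_exp_neg_mul (hY : Measurable Y) (hb : ∀ y, |Y y| ≤ 1) (t : ℝ) :
    Integrable (fun y => Real.exp (-t * Y y)) ν := by
  simpa using (isBddPos_exp_mul hY hb 0 t).integrable ν

theorem one_le_integral_exp (hY : Measurable Y) (hb : ∀ y, |Y y| ≤ 1) (h0 : ∫ y, Y y ∂ν = 0)
    (t : ℝ) : 1 ≤ ∫ y, Real.exp (-t * Y y) ∂ν := by
  have hi := (integrable_of_abs_le_one (ν := ν) hY hb).const_mul (-t)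
  have h := integral_mono (hi.add (integrable_const 1)) (integrable_exp_neg_mul hY hb t)
    fun y => Real.add_one_le_exp (-t * Y y)
  have he : ∫ y, (-t * Y y + 1) ∂ν = 1 := by
    rw [integral_add hi (integrable_const _), integral_const_mul, h0]
    simp
  exact he.symm.trans_le h

theorem integral_exp_le_exp (hY : Measurable Y) (hb : ∀ y, |Y y| ≤ 1) (h0 : ∫ y, Y y ∂ν = 0)
    {t : ℝ} (ht : 0 ≤ t) :
    ∫ y, Real.exp (-t * Y y) ∂ν ≤ Real.exp (expRem t * ∫ y, Y y ^ 2 ∂ν) := by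
  have hi := (integrable_of_abs_le_one (ν := ν) hY hb).const_mul (-t)
  have hq := (integrable_sq_of_abs_le_one (ν := ν) hY hb).mul_const (expRem t)
  have h := integral_mono (integrable_exp_neg_mul hY hb t) ((hq.add hi).add (integrable_const 1))
    fun y => by
      have := expRem_mul_le (u := -Y y) (by simpa using hb y) ht
      have hc : -Y y * t = -t * Y y := by ring
      rw [hc, neg_sq] at this
      unfold expRem at this ⊢
      simp only [Pi.add_apply]
      linarith
  have he : ∫ y, (Y y ^ 2 * expRem t + -t * Y y + 1) ∂ν = (∫ y, Y y ^ 2 ∂ν) * expRem t + 1 := by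
    rw [integral_add (f := fun y => Y y ^ 2 * expRem t + -t * Y y) (hq.add hi)
      (integrable_const _), integral_add hq hi, integral_const_mul, integral_mul_const, h0]
    simp
  refine (h.trans_eq he).trans ?_
  rw [mul_comm]
  exact Real.add_one_le_exp _

/-- The shift `c` factors out by homogeneity of entropy. With `u = -t Y`, the identity `u exp u =
exp u - 1 + entRem u` and `entRem_mul_le` bound the first term; `M log M ≥ M - 1` removes the rest,
and `M ≥ 1`, from centering, restores the factor `M`. -/
theorem ent_exp_le (hY : Measurable Y) (hb : ∀ y, |Y y| ≤ 1) (h0 : ∫ y, Y y ∂ν = 0)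
    {t : ℝ} (ht : 0 ≤ t) (c : ℝ) :
    ent ν (fun y => Real.exp (-t * (c + Y y)))
      ≤ entRem t * (∫ y, Y y ^ 2 ∂ν) * ∫ y, Real.exp (-t * (c + Y y)) ∂ν := by
  set M := ∫ y, Real.exp (-t * Y y) ∂ν with hM
  set V := ∫ y, Y y ^ 2 ∂ν with hV
  have hM1 : 1 ≤ M := one_le_integral_exp hY hb h0 t
  have hV0 : 0 ≤ V := integral_sq_nonneg
  have hsplit : ∀ y, Real.exp (-t * (c + Y y)) = Real.exp (-t * c) * Real.exp (-t * Y y) :=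
    fun y => by rw [← Real.exp_add]; ring_nf
  have hie := integrable_exp_neg_mul (ν := ν) hY hb t
  have hig : ∫ y, Real.exp (-t * (c + Y y)) ∂ν = Real.exp (-t * c) * M := by
    simp_rw [hsplit]
    rw [integral_const_mul]
  have hiY : Integrable (fun y => Real.exp (-t * Y y) * (-t * Y y)) ν := by
    have hE := isBddPos_exp_mul hY hb 0 t
    simpa using hE.integrable_mul_log hE ν
  have hlog : ∫ y, Real.exp (-t * (c + Y y)) * Real.log (Real.exp (-t * (c + Y y))) ∂ν
      = Real.exp (-t * c) * (∫ y, Real.exp (-t * Y y) * (-t * Y y) ∂ν + M * (-t * c)) := by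
    rw [hM, ← integral_mul_const, ← integral_add hiY (hie.mul_const _), ← integral_const_mul]
    refine integral_congr_ae (Filter.Eventually.of_forall fun y => ?_)
    simp only [Real.log_exp]
    rw [hsplit]
    ring
  have hq := (integrable_sq_of_abs_le_one (ν := ν) hY hb).mul_const (entRem t)
  have hent : ∫ y, Real.exp (-t * Y y) * (-t * Y y) ∂ν ≤ V * entRem t + M - 1 := by
    have h := integral_mono hiY ((hq.add hie).sub (integrable_const 1)) fun y => by
      have := entRem_mul_le (u := -Y y) (by simpa using hb y) ht
      have hc : -Y y * t = -t * Y y := by ring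
      rw [hc, neg_sq] at this
      unfold entRem at this ⊢
      simp only [Pi.add_apply, Pi.sub_apply]
      linarith
    have he : ∫ y, (Y y ^ 2 * entRem t + Real.exp (-t * Y y) - 1) ∂ν
        = V * entRem t + M - 1 := by
      rw [integral_sub (f := fun y => Y y ^ 2 * entRem t + Real.exp (-t * Y y)) (hq.add hie)
        (integrable_const _), integral_add hq hie, integral_mul_const]
      simp [hM, hV]
    exact h.trans_eq he
  have hMlog : M - 1 ≤ M * Real.log M := by
    have h1 := Real.one_sub_inv_le_log_of_pos (zero_lt_one.trans_le hM1)
    have h2 := mul_le_mul_of_nonneg_left h1 (zero_le_one.trans hM1)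
    rwa [mul_sub, mul_inv_cancel₀ (by linarith), mul_one] at h2
  have hqV : 0 ≤ entRem t * V := mul_nonneg (entRem_nonneg ht) hV0
  unfold ent
  rw [hlog, hig, Real.log_mul (Real.exp_pos _).ne' (by linarith), Real.log_exp]
  have hfin : Real.exp (-t * c) * (∫ y, Real.exp (-t * Y y) * (-t * Y y) ∂ν - M * Real.log M)
      ≤ Real.exp (-t * c) * (entRem t * V * M) := by
    refine mul_le_mul_of_nonneg_left ?_ (Real.exp_pos _).le
    nlinarith
  linarith

end

/-! ### The one-coordinate entropy inequality -/

section

variable {E : Type*} [MeasurableSpace E] {ν : Measure E} [IsProbabilityMeasure ν]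

/-- Entropy bound for the Laplace functional of a maximum of finitely many centered functions of
one coordinate, in terms of a penalised maximum. -/
theorem ent_exp_max_le {ι : Type*} [Finite ι] [Nonempty ι] {Y : ι → E → ℝ}
    (hY : ∀ i, Measurable (Y i)) (hb : ∀ i y, |Y i y| ≤ 1) (h0 : ∀ i, ∫ y, Y i y ∂ν = 0)
    (c : ι → ℝ) {t : ℝ} (ht0 : 0 < t) (ht1 : t ≤ 2 / 5) {f : E → ℝ} (hf : IsBddPos f)
    (τ : E → ι) (hτ : ∀ y, f y = Real.exp (-t * (c (τ y) + Y (τ y) y)))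
    (hmin : ∀ y i, f y ≤ Real.exp (-t * (c i + Y i y))) :
    ∃ H : ℝ, (∀ i, H ≤ -t * c i + (expRem t + entRem t / rate t) * ∫ y, Y i y ^ 2 ∂ν) ∧
      ent ν f ≤ rate t * (∫ y, f y ∂ν) * (H - Real.log (∫ y, f y ∂ν)) := by
  set κ := expRem t + entRem t / rate t with hκ
  set V : ι → ℝ := fun i => ∫ y, Y i y ^ 2 ∂ν with hV
  have hV0 : ∀ i, 0 ≤ V i := fun i => integral_sq_nonneg
  have hV1 : ∀ i, V i ≤ 1 := fun i => integral_sq_le_one (hY i) (hb i)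
  have hr := rate_pos ht0
  have hψ := expRem_nonneg t
  have hq := entRem_nonneg ht0.le
  have hκ1 : expRem t ≤ κ := by
    have : 0 ≤ entRem t / rate t := by positivity
    linarith
  have hκ2 : κ ≤ expRem t + t / 2 := by
    have : entRem t / rate t ≤ t / 2 := by
      rw [div_le_iff₀ hr]
      exact entRem_le_rate_mul ht0.le ht1
    linarith
  -- The comparison function `g` uses the index minimising the penalised exponent, chosen
  -- independently of `y`.
  obtain ⟨j, hj⟩ := Finite.exists_min fun i => -t * c i + κ * V i
  refine ⟨-t * c j + κ * V j, hj, ?_⟩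
  set p := ∫ y, f y ∂ν with hp
  have hp0 : 0 < p := hf.integral_pos ν
  set g : E → ℝ := fun y => Real.exp (-t * (c j + Y j y)) with hg
  have hgb : IsBddPos g := isBddPos_exp_mul (hY j) (hb j) (c j) t
  set G := ∫ y, g y ∂ν with hG
  have hpG : p ≤ G := integral_mono (hf.integrable ν) (hgb.integrable ν) fun y => hmin y j
  have hsplit : ∀ i, ∫ y, Real.exp (-t * (c i + Y i y)) ∂ν
      = Real.exp (-t * c i) * ∫ y, Real.exp (-t * Y i y) ∂ν := fun i => by
    rw [← integral_const_mul]
    refine integral_congr_ae (Filter.Eventually.of_forall fun y => ?_)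
    simp only [← Real.exp_add]
    ring_nf
  have hmgf : ∀ i, ∫ y, Real.exp (-t * (c i + Y i y)) ∂ν
      ≤ Real.exp (-t * c i + expRem t * V i) := fun i => by
    rw [hsplit, Real.exp_add]
    exact mul_le_mul_of_nonneg_left (integral_exp_le_exp (hY i) (hb i) (h0 i) ht0.le)
      (Real.exp_pos _).le
  have hfexp : ∀ y (a : ℝ), f y * Real.exp (t + a)
      = Real.exp (-t * c (τ y) + a + t * (1 - Y (τ y) y)) := fun y a => by
    rw [hτ y, ← Real.exp_add]
    ring_nf
  have hYτ : ∀ y, 0 ≤ t * (1 - Y (τ y) y) := fun y =>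
    mul_nonneg ht0.le (by linarith [(abs_le.1 (hb (τ y) y)).2])
  -- Both sides are compared through the index `τ y`: its mean exponential dominates `p`, and its
  -- value at `y` is `f y`. The loss is `t + expRem t = exp t - 1`.
  have hlogp : ∀ y, Real.log p ≤ Real.log (f y) + (Real.exp t - 1) := fun y => by
    have h1 : p ≤ f y * Real.exp (t + expRem t) := by
      refine (integral_mono (hf.integrable ν)
        ((isBddPos_exp_mul (hY _) (hb _) (c (τ y)) t).integrable ν)
        fun z => hmin z (τ y)).trans ((hmgf (τ y)).trans ?_)
      rw [hfexp]
      refine Real.exp_le_exp.2 ?_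
      have := mul_le_mul_of_nonneg_left (hV1 (τ y)) hψ
      linarith [hYτ y]
    have h2 := Real.log_le_log hp0 h1
    rw [Real.log_mul (hf.pos y).ne' (Real.exp_pos _).ne', Real.log_exp] at h2
    unfold expRem at h2
    linarith
  -- Minimality of `j` bounds the exponent for `G` by the penalised exponent of `τ y`, for every
  -- `y`; integration then replaces `f y` by `p`.
  have hGp : G ≤ p * Real.exp (t + κ) := by
    have h1 : ∀ y, G ≤ f y * Real.exp (t + κ) := fun y => by
      refine (hmgf j).trans ?_
      rw [hfexp]
      refine Real.exp_le_exp.2 ?_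
      have h2 := mul_le_mul_of_nonneg_left (hV1 (τ y)) (hψ.trans hκ1)
      have h3 := mul_le_mul_of_nonneg_right hκ1 (hV0 j)
      linarith [hYτ y, hj (τ y)]
    have h2 := integral_mono (integrable_const G) ((hf.integrable ν).mul_const _) h1
    rw [integral_mul_const] at h2
    simpa using h2
  have hG0 : 0 < G := hp0.trans_le hpG
  set b := Real.log (G / p) with hb'
  have hb0 : 0 ≤ b := Real.log_nonneg ((one_le_div hp0).2 hpG)
  have hbB : b ≤ Real.exp t - 1 + t / 2 := by
    have h1 : b ≤ t + κ := by
      rw [hb', Real.log_le_iff_le_exp (by positivity), div_le_iff₀ hp0, mul_comm]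
      exact hGp
    unfold expRem at hκ2
    linarith
  have hkey := exp_sub_one_mul_le_rate_mul ht0.le ht1 hb0 hbB
  rw [hb', Real.exp_log (by positivity), ← hb'] at hkey
  have hkey' : (G - p) * (t * Real.exp t) ≤ rate t * p * b := by
    have h1 := mul_le_mul_of_nonneg_left hkey hp0.le
    have h2 : p * ((G / p - 1) * (t * Real.exp t)) = (G - p) * (t * Real.exp t) := by
      field_simp
    rw [h2] at h1
    linarith
  have hblog : b = Real.log G - Real.log p := Real.log_div hG0.ne' hp0.ne'
  have hlogG : Real.log G ≤ -t * c j + expRem t * V j :=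
    (Real.log_le_iff_le_exp hG0).2 (hmgf j)
  have hentg : ent ν g ≤ entRem t * V j * G := ent_exp_le (hY j) (hb j) (h0 j) ht0.le (c j)
  -- Testing `g` against `f` leaves the error `∫ (g - f) (log p - log f)`, where `g ≥ f` and the
  -- second factor is at most `exp t - 1`.
  have hentf : ent ν f ≤ ent ν g + (Real.exp t - 1) * (G - p) := by
    have hvar := integral_mul_log_sub_le_ent hf hgb ν
    have hff := hf.integrable_mul_log hf ν
    have hgf := hgb.integrable_mul_log hf ν
    have hfi := hf.integrable ν
    have hgi := hgb.integrable ν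
    have h := integral_mono (hff.sub hgf)
      ((hgi.sub hfi).const_mul (Real.exp t - 1 - Real.log p)) fun y => by
        have h1 := mul_le_mul_of_nonneg_left (hlogp y) (sub_nonneg.2 (hmin y j))
        simp only [Pi.sub_apply, hg]
        linarith
    simp only [Pi.sub_apply] at h
    rw [integral_sub hff hgf, integral_const_mul, integral_sub hgi hfi] at h
    unfold ent at hvar ⊢
    rw [← hp, ← hG] at *
    linarith
  -- The penalty `κ` exceeds the log-Laplace coefficient `expRem t` by just enough to absorb the
  -- entropy of `g`.
  have hqr : rate t * (κ - expRem t) = entRem t := by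
    rw [hκ]
    field_simp
    ring
  have hexp : Real.exp t - 1 + entRem t = t * Real.exp t := by unfold entRem; ring
  have hVj : entRem t * V j * (G - p) ≤ entRem t * (G - p) :=
    mul_le_mul_of_nonneg_right (mul_le_of_le_one_right hq (hV1 j)) (sub_nonneg.2 hpG)
  have hpr : 0 ≤ rate t * p := by positivity
  have hlast := mul_le_mul_of_nonneg_left hlogG hpr
  calc ent ν f ≤ entRem t * V j * G + (Real.exp t - 1) * (G - p) := by linarith
    _ ≤ (G - p) * (t * Real.exp t) + entRem t * V j * p := by rw [← hexp]; linarith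
    _ ≤ rate t * p * (Real.log G - Real.log p) + rate t * (κ - expRem t) * V j * p := by
      rw [hqr, ← hblog]; linarith
    _ ≤ _ := by linarith

/-- The one-coordinate entropy inequality, expressed through a maximizing index. -/
theorem one_sub_rate_mul_ent_le {ι : Type*} [Finite ι] [Nonempty ι] [MeasurableSpace ι]
    [MeasurableSingletonClass ι] {Y : ι → E → ℝ}
    (hY : ∀ i, Measurable (Y i)) (hb : ∀ i y, |Y i y| ≤ 1) (h0 : ∀ i, ∫ y, Y i y ∂ν = 0)
    (c : ι → ℝ) {t : ℝ} (ht0 : 0 < t) (ht1 : t ≤ 2 / 5) {f : E → ℝ} (hf : IsBddPos f)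
    (τ : E → ι) (hτm : Measurable τ) (hτ : ∀ y, f y = Real.exp (-t * (c (τ y) + Y (τ y) y)))
    (hmin : ∀ y i, f y ≤ Real.exp (-t * (c i + Y i y))) :
    (1 - rate t) * ent ν f ≤ ∫ y, f y * (rate t * t * Y (τ y) y
      + (rate t * expRem t + entRem t) * ∫ z, Y (τ y) z ^ 2 ∂ν) ∂ν := by
  obtain ⟨H, hH, hent⟩ := ent_exp_max_le hY hb h0 c ht0 ht1 hf τ hτ hmin
  have hr := rate_pos ht0
  have hκ : rate t * (expRem t + entRem t / rate t) = rate t * expRem t + entRem t := by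
    field_simp
  have hYm : Measurable fun y => Y (τ y) y :=
    (measurable_from_prod_countable_right (f := fun p : ι × E => Y p.1 p.2) hY).comp
      (hτm.prodMk measurable_id)
  have hVm : Measurable fun y => ∫ z, Y (τ y) z ^ 2 ∂ν :=
    (measurable_of_countable fun i => ∫ z, Y i z ^ 2 ∂ν).comp hτm
  -- The frozen constant `c (τ y)` occurs in both `H` and `log f y`, and cancels in `H - log f y`.
  have hpt : ∀ y, rate t * (f y * H - f y * Real.log (f y)) ≤ f y * (rate t * t * Y (τ y) y
      + (rate t * expRem t + entRem t) * ∫ z, Y (τ y) z ^ 2 ∂ν) := fun y => by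
    have h1 := mul_le_mul_of_nonneg_left (hH (τ y)) (mul_pos hr (hf.pos y)).le
    have hl : Real.log (f y) = -t * (c (τ y) + Y (τ y) y) := by rw [hτ y, Real.log_exp]
    rw [hl, ← hκ]
    linarith
  have hff := hf.integrable_mul_log hf ν
  have hfi := hf.integrable ν
  obtain ⟨C, hC0, hC⟩ := hf.exists_abs_le
  have hrhs : Integrable (fun y => f y * (rate t * t * Y (τ y) y
      + (rate t * expRem t + entRem t) * ∫ z, Y (τ y) z ^ 2 ∂ν)) ν := by
    refine integrable_of_abs_le (hf.1.mul ((hYm.const_mul _).add (hVm.const_mul _)))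
      (C := C * (|rate t * t| * 1 + |rate t * expRem t + entRem t| * 1)) fun y => ?_
    rw [abs_mul]
    refine mul_le_mul (hC y) ((abs_add_le _ _).trans ?_) (abs_nonneg _) hC0
    rw [abs_mul, abs_mul (rate t * expRem t + entRem t)]
    refine add_le_add (mul_le_mul_of_nonneg_left (hb _ y) (abs_nonneg _))
      (mul_le_mul_of_nonneg_left ?_ (abs_nonneg _))
    rw [abs_of_nonneg integral_sq_nonneg]
    exact integral_sq_le_one (hY _) (hb _)
  have h := integral_mono (((hfi.mul_const H).sub hff).const_mul (rate t)) hrhs hpt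
  simp only [Pi.sub_apply] at h
  rw [integral_const_mul, integral_sub (hfi.mul_const H) hff, integral_mul_const] at h
  -- As `p (H - log p) = ∫ f (H - log f) + ent ν f`, the entropy reappears with factor `rate t` and
  -- moves to the left.
  refine le_trans ?_ h
  unfold ent at hent ⊢
  linarith

end

/-! ### Resampling, measurable maximisers and the sum over coordinates -/

/-- Resampling one coordinate preserves a product probability measure. -/
theorem measurePreserving_update {E : Type*} [MeasurableSpace E] {n : ℕ} (ν : Fin n → Measure E)
    [∀ k, IsProbabilityMeasure (ν k)] (k : Fin n) :
    MeasurePreserving (fun p : (Fin n → E) × E => Function.update p.1 k p.2)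
      ((Measure.pi ν).prod (ν k)) (Measure.pi ν) := by
  refine ⟨measurable_update_prod k, (Measure.pi_eq fun A hA => ?_).symm⟩
  have hpre : (fun p : (Fin n → E) × E => Function.update p.1 k p.2) ⁻¹' (Set.univ.pi A)
      = (Set.univ.pi (Function.update A k Set.univ)) ×ˢ (A k) := by
    ext p
    simp only [Set.mem_preimage, Set.mem_pi, Set.mem_univ, true_implies, Set.mem_prod]
    constructor
    · refine fun h => ⟨fun j => ?_, by simpa using h k⟩
      by_cases hj : j = k
      · subst hj; simp
      · simpa [Function.update_of_ne hj] using h j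
    · rintro ⟨h1, h2⟩ j
      by_cases hj : j = k
      · subst hj; simpa using h2
      · simpa [Function.update_of_ne hj] using h1 j
  rw [Measure.map_apply (measurable_update_prod k) (MeasurableSet.univ_pi hA), hpre,
    Measure.prod_prod, Measure.pi_pi, ← Finset.mul_prod_erase _ _ (Finset.mem_univ k),
    ← Finset.mul_prod_erase (Finset.univ) (fun j => ν j (A j)) (Finset.mem_univ k)]
  have : ∏ j ∈ Finset.univ.erase k, ν j (Function.update A k Set.univ j)
      = ∏ j ∈ Finset.univ.erase k, ν j (A j) :=
    Finset.prod_congr rfl fun j hj => by rw [Function.update_of_ne (Finset.ne_of_mem_erase hj)]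
  rw [this]
  simp [mul_comm]

/-- Turns the averaged slice bounds produced by subadditivity back into integrals over the original
product space. -/
theorem integral_integral_update {E : Type*} [MeasurableSpace E] {n : ℕ} (ν : Fin n → Measure E)
    [∀ k, IsProbabilityMeasure (ν k)] (k : Fin n) {F : (Fin n → E) → ℝ}
    (hF : Measurable F) (hi : Integrable F (Measure.pi ν)) :
    Integrable (fun x => ∫ y, F (Function.update x k y) ∂(ν k)) (Measure.pi ν) ∧
      ∫ x, ∫ y, F (Function.update x k y) ∂(ν k) ∂(Measure.pi ν) = ∫ x, F x ∂(Measure.pi ν) := by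
  have hmp := measurePreserving_update ν k
  have hi' := hmp.integrable_comp_of_integrable hi
  refine ⟨hi'.integral_prod_left, ?_⟩
  have h := integral_prod _ hi'
  simp only [Function.comp] at h
  rw [← h]
  have hmap := integral_map (μ := (Measure.pi ν).prod (ν k)) (f := F)
    hmp.measurable.aemeasurable hF.aestronglyMeasurable
  rw [hmp.map_eq] at hmap
  exact hmap.symm

/-- A measurable choice of a maximizing index. -/
theorem exists_measurable_argmax {α : Type*} [MeasurableSpace α] {m : ℕ}
    {S : Fin (m + 1) → α → ℝ} (hS : ∀ i, Measurable (S i)) :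
    ∃ τ : α → Fin (m + 1), Measurable τ ∧ ∀ x i, S i x ≤ S (τ x) x := by
  classical
  have hne : ∀ x, (Finset.univ.filter fun i => ∀ j, S j x ≤ S i x).Nonempty := fun x => by
    obtain ⟨i, hi⟩ := Finite.exists_max fun i => S i x
    exact ⟨i, by simpa using hi⟩
  -- Ties go to the least maximising index, so each level set is cut out by finitely many
  -- comparisons of measurable functions.
  refine ⟨fun x => (Finset.univ.filter fun i => ∀ j, S j x ≤ S i x).min' (hne x), ?_, ?_⟩
  · refine measurable_to_countable' fun i => ?_
    have hset : (fun x => (Finset.univ.filter fun i => ∀ j, S j x ≤ S i x).min' (hne x)) ⁻¹' {i}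
        = {x | ∀ j, S j x ≤ S i x} ∩ ⋂ l : Fin (m + 1), {x | l < i → ¬ ∀ j, S j x ≤ S l x} := by
      ext x
      simp only [Set.mem_preimage, Set.mem_singleton_iff, Set.mem_inter_iff, Set.mem_ofPred_eq,
        Set.mem_iInter]
      rw [Finset.min'_eq_iff]
      simp only [Finset.mem_filter, Finset.mem_univ, true_and]
      refine and_congr_right fun _ => forall_congr' fun l => ?_
      rw [← not_lt]
      tauto
    have hle : ∀ l, MeasurableSet {x | ∀ j, S j x ≤ S l x} := fun l => by
      rw [Set.ofPred_forall]
      exact MeasurableSet.iInter fun j => measurableSet_le (hS j) (hS l)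
    rw [hset]
    refine (hle i).inter (MeasurableSet.iInter fun l => ?_)
    by_cases hl : l < i
    · have hc : {x | l < i → ¬ ∀ j, S j x ≤ S l x} = {x | ∀ j, S j x ≤ S l x}ᶜ := by
        ext x
        simp only [hl, true_implies, Set.mem_ofPred_eq, Set.mem_compl_iff]
      rw [hc]
      exact (hle l).compl
    · simp [hl]
  · intro x i
    have h := Finset.min'_mem _ (hne x)
    simp only [Finset.mem_filter, Finset.mem_univ, true_and] at h
    exact h i

theorem sum_update {E : Type*} {n : ℕ} (u : E → Fin n → ℝ) (x : Fin n → E) (k : Fin n) (y : E) :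
    ∑ j, u (Function.update x k y j) j
      = ∑ j ∈ Finset.univ.erase k, u (x j) j + u y k := by
  rw [← Finset.sum_erase_add _ _ (Finset.mem_univ k), Function.update_self]
  congr 1
  exact Finset.sum_congr rfl fun j hj => by
    rw [Function.update_of_ne (Finset.ne_of_mem_erase hj)]

theorem abs_sum_le {E : Type*} {n : ℕ} {u : E → Fin n → ℝ} (hb : ∀ y k, |u y k| ≤ 1)
    (x : Fin n → E) :
    |∑ k, u (x k) k| ≤ n := by
  refine (Finset.abs_sum_le_sum_abs _ _).trans ?_
  simpa using Finset.sum_le_sum fun k (_ : k ∈ Finset.univ) => hb (x k) k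

section

variable {E : Type*} [MeasurableSpace E] {n m : ℕ}

theorem measurable_sum_apply {u : E → Fin n → ℝ} (hu : Measurable u) :
    Measurable fun x : Fin n → E => ∑ k, u (x k) k :=
  Finset.measurable_sum _ fun k _ => ((measurable_pi_apply k).comp hu).comp (measurable_pi_apply k)

/-- The entropy inequality for the maximum of a finite family of centered sums. -/
theorem one_sub_rate_mul_ent_max_le (ν : Fin n → Measure E) [∀ k, IsProbabilityMeasure (ν k)]
    {s : Fin (m + 1) → E → Fin n → ℝ} (hs : ∀ i, Measurable (s i))
    (hb : ∀ i y k, |s i y k| ≤ 1) (h0 : ∀ i k, ∫ y, s i y k ∂(ν k) = 0)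
    {V : ℝ} (hV : ∀ i, ∑ k, ∫ y, s i y k ^ 2 ∂(ν k) ≤ V)
    {Z : (Fin n → E) → ℝ} {τ : (Fin n → E) → Fin (m + 1)} (hτm : Measurable τ)
    (hτ : ∀ x, Z x = ∑ k, s (τ x) (x k) k) (hmax : ∀ x i, ∑ k, s i (x k) k ≤ Z x)
    {t : ℝ} (ht0 : 0 < t) (ht1 : t ≤ 2 / 5) :
    (1 - rate t) * ent (Measure.pi ν) (fun x => Real.exp (-t * Z x))
      ≤ rate t * t * ∫ x, Real.exp (-t * Z x) * Z x ∂(Measure.pi ν)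
        + (rate t * expRem t + entRem t) * V * ∫ x, Real.exp (-t * Z x) ∂(Measure.pi ν) := by
  set P := Measure.pi ν
  set K := rate t * expRem t + entRem t with hK
  have hr := rate_pos ht0
  have hK0 : 0 ≤ K := add_nonneg (mul_nonneg hr.le (expRem_nonneg t)) (entRem_nonneg ht0.le)
  have hsk : ∀ i k, Measurable fun y => s i y k := fun i k => (measurable_pi_apply k).comp (hs i)
  have hWm : ∀ k, Measurable fun x : Fin n → E => s (τ x) (x k) k := fun k =>
    (measurable_from_prod_countable_right (f := fun p : Fin (m + 1) × E => s p.1 p.2 k)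
      fun i => hsk i k).comp (hτm.prodMk (measurable_pi_apply k))
  have hZm : Measurable Z := by
    rw [funext hτ]
    exact Finset.measurable_sum _ fun k _ => hWm k
  have hZb : ∀ x, |Z x| ≤ n := fun x => by
    rw [hτ x]
    exact abs_sum_le (hb (τ x)) x
  set f : (Fin n → E) → ℝ := fun x => Real.exp (-t * Z x) with hf
  have hfb : IsBddPos f := isBddPos_exp (hZm.const_mul (-t)) (C := t * n) fun x => by
    rw [abs_mul, abs_neg, abs_of_pos ht0]
    exact mul_le_mul_of_nonneg_left (hZb x) ht0.le
  set R : Fin n → (Fin n → E) → ℝ := fun k x =>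
    f x * (rate t * t * s (τ x) (x k) k + K * ∫ z, s (τ x) z k ^ 2 ∂(ν k)) with hR
  have hVm : ∀ k, Measurable fun x => ∫ z, s (τ x) z k ^ 2 ∂(ν k) := fun k =>
    (measurable_of_countable fun i => ∫ z, s i z k ^ 2 ∂(ν k)).comp hτm
  have hRm : ∀ k, Measurable (R k) := fun k =>
    hfb.1.mul (((hWm k).const_mul _).add ((hVm k).const_mul _))
  obtain ⟨C, hC0, hC⟩ := hfb.exists_abs_le
  have hRi : ∀ k, Integrable (R k) P := fun k => by
    refine integrable_of_abs_le (hRm k)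
      (C := C * (|rate t * t| * 1 + |K| * 1)) fun x => ?_
    rw [abs_mul]
    refine mul_le_mul (hC x) ((abs_add_le _ _).trans ?_) (abs_nonneg _) hC0
    rw [abs_mul, abs_mul K]
    refine add_le_add (mul_le_mul_of_nonneg_left (hb _ _ _) (abs_nonneg _))
      (mul_le_mul_of_nonneg_left ?_ (abs_nonneg _))
    rw [abs_of_nonneg integral_sq_nonneg]
    exact integral_sq_le_one (hsk _ k) (fun y => hb _ y k)
  have hcoord : ∀ k x, (1 - rate t) * ent (ν k) (fun y => f (Function.update x k y))
      ≤ ∫ y, R k (Function.update x k y) ∂(ν k) := fun k x => by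
    have hup : Measurable (Function.update x k) := measurable_update x
    -- The sum over the frozen coordinates plays the role of `c i`; the maximiser depends on the
    -- resampled value.
    have h := one_sub_rate_mul_ent_le (ν := ν k) (Y := fun i y => s i y k)
      (fun i => hsk i k) (fun i y => hb i y k) (fun i => h0 i k)
      (fun i => ∑ j ∈ Finset.univ.erase k, s i (x j) j) ht0 ht1 (hfb.comp hup)
      (fun y => τ (Function.update x k y)) (hτm.comp hup)
      (fun y => by simp only [hf]; rw [hτ, sum_update])
      (fun y i => by
        simp only [hf]
        rw [← sum_update]
        exact Real.exp_le_exp.2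
          (mul_le_mul_of_nonpos_left (hmax _ i) (neg_nonpos.2 ht0.le)))
    simpa only [hR, Function.update_self] using h
  have hsum : (1 - rate t) * ent P f ≤ ∑ k, ∫ x, R k x ∂P := by
    refine (mul_le_mul_of_nonneg_left (ent_pi_le ν hfb)
      (sub_nonneg.2 (rate_le_one ht0.le ht1))).trans ?_
    rw [Finset.mul_sum]
    refine Finset.sum_le_sum fun k _ => ?_
    obtain ⟨hi, he⟩ := integral_integral_update ν k (hRm k) (hRi k)
    rw [← he, ← integral_const_mul]
    exact integral_mono ((integrable_ent_update hfb P (ν k) k).const_mul _) hi (hcoord k)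
  refine hsum.trans ?_
  have hfZ : Integrable (fun x => f x * Z x) P := by
    refine integrable_of_abs_le (hfb.1.mul hZm) (C := C * n) fun x => ?_
    rw [abs_mul]
    exact mul_le_mul (hC x) (hZb x) (abs_nonneg _) hC0
  rw [← integral_finsetSum _ fun k _ => hRi k, ← integral_const_mul, ← integral_const_mul,
    ← integral_add (hfZ.const_mul _) ((hfb.integrable P).const_mul _)]
  refine integral_mono (integrable_finsetSum _ fun k _ => hRi k)
    ((hfZ.const_mul _).add ((hfb.integrable P).const_mul _)) fun x => ?_
  -- At a fixed `x` all coordinates share the maximiser `τ x`, so the summands add up to `Z x`.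
  have h1 : ∑ k, R k x = f x * (rate t * t * Z x + K * ∑ k, ∫ z, s (τ x) z k ^ 2 ∂(ν k)) := by
    rw [hτ x]
    simp only [hR]
    rw [← Finset.mul_sum, Finset.sum_add_distrib, ← Finset.mul_sum, ← Finset.mul_sum]
  have h2 := mul_le_mul_of_nonneg_left (mul_le_mul_of_nonneg_left (hV (τ x)) hK0) (hfb.pos x).le
  rw [h1]
  linarith

/-- Bennett's bound for the lower Laplace transform of a sum of independent variables. -/
theorem integral_exp_sum_le (ν : Fin n → Measure E) [∀ k, IsProbabilityMeasure (ν k)]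
    {u : E → Fin n → ℝ} (hu : Measurable u) (hb : ∀ y k, |u y k| ≤ 1)
    (h0 : ∀ k, ∫ y, u y k ∂(ν k) = 0) {t : ℝ} (ht : 0 ≤ t) :
    ∫ x, Real.exp (-t * ∑ k, u (x k) k) ∂(Measure.pi ν)
      ≤ Real.exp (expRem t * ∑ k, ∫ y, u y k ^ 2 ∂(ν k)) := by
  simp_rw [Finset.mul_sum, Real.exp_sum]
  rw [integral_fintype_prod_eq_prod (fun k y => Real.exp (-t * u y k))]
  refine Finset.prod_le_prod (fun k _ => integral_nonneg fun y => (Real.exp_pos _).le) fun k _ => ?_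
  exact integral_exp_le_exp ((measurable_pi_apply k).comp hu) (fun y => hb y k) (h0 k) ht

end

/-! ### Solving the differential inequality -/

/-- The Bennett-type target for the log-Laplace transform at `-t`. -/
noncomputable def target (z V t : ℝ) : ℝ := -t * z + (2 * z + V) / 9 * expRem (3 * t)

theorem hasDerivAt_target (z V t : ℝ) :
    HasDerivAt (target z V) (-z + (2 * z + V) / 9 * (3 * (Real.exp (3 * t) - 1))) t := by
  have h : HasDerivAt (target z V)
      (-1 * z + (2 * z + V) / 9 * (3 * (Real.exp (3 * t) - 1))) t :=
    ((hasDerivAt_id t).neg.mul_const z).add ((hasDerivAt_expRem_const_mul 3 t).const_mul _)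
  convert! h using 1
  ring

section

variable {l l' : ℝ → ℝ} {z V : ℝ}

/-- Comparison for the differential inequality on the initial interval. -/
theorem le_target_of_le_two_fifths (hl : ∀ t, HasDerivAt l (l' t) t) (hl0 : l 0 = 0)
    (hl'0 : l' 0 = -z) (hz : 0 ≤ z) (hV : 0 ≤ V)
    (hode : ∀ t, 0 < t → t ≤ 2 / 5 →
      t * l' t ≤ (1 - rate t) * l t + (rate t * expRem t + entRem t) * V)
    {t : ℝ} (ht0 : 0 < t) (ht1 : t ≤ 2 / 5) : l t ≤ target z V t := by
  set T' : ℝ → ℝ := fun t => -z + (2 * z + V) / 9 * (3 * (Real.exp (3 * t) - 1)) with hT'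
  set d : ℝ → ℝ := fun t => l t - target z V t with hd
  have hdd : ∀ x, HasDerivAt d (l' x - T' x) x := fun x => (hl x).sub (hasDerivAt_target z V x)
  -- `A' x = rate x / x`, so `exp (A x) / x` is an integrating factor for `x d' ≤ (1 - rate x) d`.
  set A : ℝ → ℝ := fun x => x + 3 / 2 * x ^ 2 + x ^ 3 / 3 with hA
  have hAd : ∀ x, HasDerivAt A (1 + 3 * x + x ^ 2) x := fun x => by
    have h : HasDerivAt A (1 + 3 / 2 * ((2 : ℕ) * x ^ (2 - 1)) + (3 : ℕ) * x ^ (3 - 1) / 3) x :=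
      ((hasDerivAt_id x).add ((hasDerivAt_pow 2 x).const_mul _)).add
        ((hasDerivAt_pow 3 x).div_const 3)
    convert! h using 1
    norm_num
    ring
  set D : ℝ → ℝ := fun x => Real.exp (A x) * (d x / x) with hD
  have hDd : ∀ x, x ≠ 0 → HasDerivAt D (Real.exp (A x) * (1 + 3 * x + x ^ 2) * (d x / x)
      + Real.exp (A x) * (((l' x - T' x) * x - d x * 1) / x ^ 2)) x := fun x hx =>
    (hAd x).exp.mul ((hdd x).div (hasDerivAt_id x) hx)
  have hanti : AntitoneOn D (Set.Ioc 0 (2 / 5)) := by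
    refine antitoneOn_of_deriv_nonpos (convex_Ioc _ _)
      (fun x hx => (hDd x hx.1.ne').continuousAt.continuousWithinAt)
      (fun x hx => ?_) fun x hx => ?_
    · rw [interior_Ioc] at hx
      exact (hDd x hx.1.ne').differentiableAt.differentiableWithinAt
    · rw [interior_Ioc] at hx
      have hx0 : 0 < x := hx.1
      rw [(hDd x hx0.ne').deriv]
      have h1 := hode x hx0 hx.2.le
      have h2 := target_supersolution hx0.le hz hV
      have h3 : x * (l' x - T' x) ≤ (1 - rate x) * d x := by
        simp only [hd, hT', target]
        linarith
      have h4 : Real.exp (A x) * (1 + 3 * x + x ^ 2) * (d x / x)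
          + Real.exp (A x) * (((l' x - T' x) * x - d x * 1) / x ^ 2)
          = Real.exp (A x) * ((x * (l' x - T' x) - (1 - rate x) * d x) / x ^ 2) := by
        unfold rate
        field_simp
        ring
      rw [h4]
      exact mul_nonpos_of_nonneg_of_nonpos (Real.exp_pos _).le
        (div_nonpos_of_nonpos_of_nonneg (by linarith) (sq_nonneg x))
  have hd0 : d 0 = 0 := by simp [hd, target, hl0, expRem_zero]
  -- `d x / x` tends to `d' 0`, which vanishes because `l` and the target both have slope `-z` at
  -- `0`.
  have hlim : Filter.Tendsto D (nhdsWithin 0 (Set.Ioi 0)) (nhds 0) := by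
    have h1 := (hdd 0).tendsto_slope_zero_right
    have h2 : l' 0 - T' 0 = 0 := by simp [hT', hl'0]
    rw [h2] at h1
    have h3 : Filter.Tendsto (fun x => Real.exp (A x)) (nhdsWithin 0 (Set.Ioi 0))
        (nhds (Real.exp (A 0))) := ((hAd 0).continuousAt.rexp).tendsto.mono_left nhdsWithin_le_nhds
    have h4 := h3.mul h1
    rw [mul_zero] at h4
    refine h4.congr fun x => ?_
    simp only [hD, zero_add, hd0, sub_zero, smul_eq_mul]
    rw [div_eq_inv_mul]
  have hle : D t ≤ 0 := by
    refine ge_of_tendsto hlim ?_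
    filter_upwards [Ioc_mem_nhdsGT ht0] with x hx
    exact hanti ⟨hx.1, hx.2.trans ht1⟩ ⟨ht0, ht1⟩ hx.2
  have h5 : d t / t ≤ 0 := nonpos_of_mul_nonpos_right hle (Real.exp_pos _)
  have h6 : d t ≤ 0 := by
    have := (div_le_iff₀ ht0).1 h5
    simpa using this
  simp only [hd] at h6
  linarith

/-- The `V`-part holds for every `t ≥ 0`. The `z`-part needs `2/9 * expRem (3 t) ≥ t`, which follows
from `t + t ^ 2 ≥ 1`. -/
theorem target_ge_of_seven_tenths_le (hz : 0 ≤ z) (hV : 0 ≤ V) {t : ℝ} (ht : 7 / 10 ≤ t) :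
    expRem t * V ≤ target z V t := by
  have ht0 : 0 ≤ t := by linarith
  have h1 := sq_add_cube_le_expRem ht0
  have h2 := nine_mul_expRem_le ht0
  have h3 : t ≤ t ^ 2 + t ^ 3 := by nlinarith [sq_nonneg t]
  have h4 := mul_nonneg hz (by linarith : 0 ≤ 2 / 9 * expRem (3 * t) - t)
  have h5 := mul_nonneg hV (by linarith : 0 ≤ expRem (3 * t) - 9 * expRem t)
  unfold target
  linarith

/-- Extension of the comparison to the whole half-line, by convexity and the bound for a single
sum. -/
theorem le_target (hl : ∀ t, HasDerivAt l (l' t) t) (hl0 : l 0 = 0)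
    (hl'0 : l' 0 = -z) (hz : 0 ≤ z) (hV : 0 ≤ V) (hconv : ConvexOn ℝ Set.univ l)
    (hode : ∀ t, 0 < t → t ≤ 2 / 5 →
      t * l' t ≤ (1 - rate t) * l t + (rate t * expRem t + entRem t) * V)
    (hsingle : ∀ t, 0 ≤ t → l t ≤ expRem t * V)
    {t : ℝ} (ht0 : 0 < t) : l t ≤ target z V t := by
  rcases le_or_gt t (2 / 5) with ht1 | ht1
  · exact le_target_of_le_two_fifths hl hl0 hl'0 hz hV hode ht0 ht1
  rcases le_or_gt (7 / 10) t with ht2 | ht2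
  · exact (hsingle t ht0.le).trans (target_ge_of_seven_tenths_le hz hV ht2)
  have hA := le_target_of_le_two_fifths hl hl0 hl'0 hz hV hode (by norm_num) (le_refl (2 / 5))
  have hB := hsingle (7 / 10) (by norm_num)
  set w := (7 / 10 - t) / (3 / 10) with hw
  have hw0 : 0 ≤ w := by rw [hw]; apply div_nonneg <;> linarith
  have hw1 : 0 ≤ 1 - w := by
    rw [hw, sub_nonneg, div_le_one (by norm_num)]
    linarith
  have htw : t = 7 / 10 - 3 / 10 * w := by rw [hw]; ring
  have hc := hconv.2 (Set.mem_univ (2 / 5)) (Set.mem_univ (7 / 10)) hw0 hw1 (by ring)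
  have htc : w • (2 / 5 : ℝ) + (1 - w) • (7 / 10 : ℝ) = t := by
    simp only [smul_eq_mul]
    linarith
  rw [htc] at hc
  simp only [smul_eq_mul] at hc
  refine hc.trans ?_
  set a := Real.exp (6 / 5) with ha
  -- This precision is needed: at `t = 7/10` the `z`-coefficient of the tangent bound, `-7/10 + 2/9
  -- (19/10 a - 31/10)`, is barely nonnegative for `a = 329/100`.
  have ha1 : 329 / 100 ≤ a := by
    have h := Real.sum_le_exp_of_nonneg (by norm_num : (0 : ℝ) ≤ 6 / 5) 5
    simp only [Finset.sum_range_succ, Finset.sum_range_zero, Nat.factorial] at h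
    norm_num at h
    linarith
  have hb1 : expRem (7 / 10) ≤ 33 / 100 := by
    have := exp_le_cubic (x := 7 / 10) (by norm_num) (by norm_num)
    unfold expRem
    linarith
  -- The tangent at `t = 2/5` makes the lower bound for the target affine in `t`, like the chord
  -- bounding `l`. They are then compared at the endpoints, the target itself being recovered at
  -- `2/5`.
  have htan : a * (1 + (3 * t - 6 / 5)) ≤ Real.exp (3 * t) := by
    have h1 : Real.exp (3 * t) = a * Real.exp (3 * t - 6 / 5) := by
      rw [ha, ← Real.exp_add]
      ring_nf
    rw [h1]
    exact mul_le_mul_of_nonneg_left (by linarith [Real.add_one_le_exp (3 * t - 6 / 5)])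
      (Real.exp_pos _).le
  have hT2 : target z V (2 / 5) = -(2 / 5) * z + (2 * z + V) / 9 * (a - 11 / 5) := by
    unfold target expRem
    have h1 : (3 : ℝ) * (2 / 5) = 6 / 5 := by norm_num
    rw [h1, ← ha]
    ring
  have hTt : -t * z + (2 * z + V) / 9 * (a * (1 + (3 * t - 6 / 5)) - 3 * t - 1)
      ≤ target z V t := by
    unfold target expRem
    have : 0 ≤ (2 * z + V) / 9 := by positivity
    linarith [mul_le_mul_of_nonneg_left htan this]
  refine le_trans ?_ hTt
  have e1 := mul_le_mul_of_nonneg_left hA hw0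
  have e2 := mul_le_mul_of_nonneg_left hB hw1
  rw [hT2] at e1
  have e3 := mul_nonneg (mul_nonneg hw1 hz) (by linarith : 0 ≤ a - 329 / 100)
  have e4 := mul_nonneg (mul_nonneg hw1 hV) (by linarith : 0 ≤ a - 329 / 100)
  have e5 := mul_nonneg (mul_nonneg hw1 hV) (by linarith : 0 ≤ 33 / 100 - expRem (7 / 10))
  have e6 := mul_nonneg hw1 hz
  have e7 := mul_nonneg hw1 hV
  rw [htw]
  nlinarith

end

/-! ### Laplace bound for a finite maximum -/

theorem integrable_exp_mul_of_abs_le {Ω : Type*} [MeasurableSpace Ω] {P : Measure Ω}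
    [IsProbabilityMeasure P] {Z : Ω → ℝ} (hZ : Measurable Z) {C : ℝ} (hC : ∀ x, |Z x| ≤ C)
    (t : ℝ) : Integrable (fun x => Real.exp (t * Z x)) P :=
  (isBddPos_exp (hZ.const_mul t) (C := |t| * C) fun x => by
    rw [abs_mul]
    exact mul_le_mul_of_nonneg_left (hC x) (abs_nonneg t)).integrable P

theorem mem_interior_integrableExpSet {Ω : Type*} [MeasurableSpace Ω] {P : Measure Ω}
    [IsProbabilityMeasure P] {Z : Ω → ℝ} (hZ : Measurable Z) {C : ℝ} (hC : ∀ x, |Z x| ≤ C)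
    (t : ℝ) : t ∈ interior (integrableExpSet Z P) := by
  have h : integrableExpSet Z P = Set.univ :=
    Set.eq_univ_of_forall (integrable_exp_mul_of_abs_le hZ hC)
  rw [h, interior_univ]
  trivial

/-- The second derivative is a variance under the exponentially tilted law. -/
theorem convexOn_cgf_of_bounded {Ω : Type*} [MeasurableSpace Ω] {P : Measure Ω}
    [IsProbabilityMeasure P] {Z : Ω → ℝ} (hZ : Measurable Z) {C : ℝ} (hC : ∀ x, |Z x| ≤ C) :
    ConvexOn ℝ Set.univ (cgf Z P) := by
  have hint := mem_interior_integrableExpSet (P := P) hZ hC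
  have han : ∀ x, AnalyticAt ℝ (cgf Z P) x := fun x => analyticAt_cgf (hint x)
  refine convexOn_univ_of_deriv2_nonneg (fun x => (han x).differentiableAt)
    (fun x => (han x).deriv.differentiableAt) fun x => ?_
  rw [← iteratedDeriv_eq_iterate, iteratedDeriv_two_cgf_eq_integral (hint x)]
  exact div_nonneg (integral_nonneg fun y => mul_nonneg (sq_nonneg _) (Real.exp_pos _).le)
    mgf_nonneg

/-- The left-tail Laplace bound for the maximum of a finite family, on the product space. -/
theorem cgf_max_le_target {E : Type*} [MeasurableSpace E] {n m : ℕ}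
    (ν : Fin n → Measure E) [∀ k, IsProbabilityMeasure (ν k)]
    {s : Fin (m + 1) → E → Fin n → ℝ} (hs : ∀ i, Measurable (s i))
    (hb : ∀ i y k, |s i y k| ≤ 1) (h0 : ∀ i k, ∫ y, s i y k ∂(ν k) = 0)
    {V : ℝ} (hV : ∀ i, ∑ k, ∫ y, s i y k ^ 2 ∂(ν k) ≤ V)
    {Z : (Fin n → E) → ℝ} {τ : (Fin n → E) → Fin (m + 1)} (hτm : Measurable τ)
    (hτ : ∀ x, Z x = ∑ k, s (τ x) (x k) k) (hmax : ∀ x i, ∑ k, s i (x k) k ≤ Z x)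
    {t : ℝ} (ht : 0 < t) :
    cgf Z (Measure.pi ν) (-t) ≤ target (∫ x, Z x ∂(Measure.pi ν)) V t := by
  set P := Measure.pi ν with hP
  have hZm : Measurable Z := by
    rw [funext hτ]
    exact Finset.measurable_sum _ fun k _ =>
      (measurable_from_prod_countable_right (f := fun p : Fin (m + 1) × E => s p.1 p.2 k)
        fun i => (measurable_pi_apply k).comp (hs i)).comp (hτm.prodMk (measurable_pi_apply k))
  have hZb : ∀ x, |Z x| ≤ n := fun x => by
    rw [hτ x]
    exact abs_sum_le (hb (τ x)) x
  have hint := mem_interior_integrableExpSet (P := P) hZm hZb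
  have hexp := integrable_exp_mul_of_abs_le (P := P) hZm hZb
  have hV0 : 0 ≤ V := (Finset.sum_nonneg fun k _ => integral_sq_nonneg).trans (hV 0)
  have hz : 0 ≤ ∫ x, Z x ∂P := by
    have hS := measurable_sum_apply (hs 0)
    have hi : ∀ k, Integrable (fun x : Fin n → E => s 0 (x k) k) P := fun k =>
      integrable_of_abs_le (((measurable_pi_apply k).comp (hs 0)).comp (measurable_pi_apply k))
        fun x => hb 0 (x k) k
    have h1 : ∫ x, ∑ k, s 0 (x k) k ∂P = 0 := by
      rw [integral_finsetSum _ fun k _ => hi k]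
      refine Finset.sum_eq_zero fun k _ => ?_
      rw [← h0 0 k, ← (measurePreserving_eval ν k).map_eq,
        integral_map (measurable_pi_apply k).aemeasurable
          ((measurable_pi_apply k).comp (hs 0)).aestronglyMeasurable]
    rw [← h1]
    exact integral_mono (integrable_of_abs_le hS (abs_sum_le (hb 0)))
      (integrable_of_abs_le hZm hZb) fun x => hmax x 0
  have hdcgf : ∀ t, HasDerivAt (fun t => cgf Z P (-t)) (-deriv (cgf Z P) (-t)) t := fun t => by
    have h1 : HasDerivAt (cgf Z P) (deriv (cgf Z P) (-t)) (-t) :=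
      (analyticAt_cgf (hint (-t))).differentiableAt.hasDerivAt
    have h2 := h1.comp t (hasDerivAt_neg t)
    rwa [mul_neg_one] at h2
  refine le_target (l := fun t => cgf Z P (-t)) hdcgf (by simp) ?_ hz hV0 ?_ ?_ ?_ ht
  · rw [neg_zero, deriv_cgf_zero (hint 0)]
    simp
  · have hc := convexOn_cgf_of_bounded (P := P) hZm hZb
    have hc' := hc.comp_linearMap (-LinearMap.id)
    exact hc'
  · intro t ht0 ht1
    have hent := one_sub_rate_mul_ent_max_le ν hs hb h0 hV hτm hτ hmax ht0 ht1
    have hM : 0 < mgf Z P (-t) := mgf_pos (hexp (-t))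
    have hmgf : ∫ x, Real.exp (-t * Z x) ∂P = mgf Z P (-t) := rfl
    have hd : deriv (cgf Z P) (-t) * mgf Z P (-t) = ∫ x, Real.exp (-t * Z x) * Z x ∂P := by
      rw [deriv_cgf (hint (-t)), div_mul_cancel₀ _ hM.ne']
      exact integral_congr_ae (Filter.Eventually.of_forall fun x => mul_comm _ _)
    have hlog : ∫ x, Real.exp (-t * Z x) * Real.log (Real.exp (-t * Z x)) ∂P
        = -t * ∫ x, Real.exp (-t * Z x) * Z x ∂P := by
      simp_rw [Real.log_exp]
      rw [← integral_const_mul]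
      exact integral_congr_ae (Filter.Eventually.of_forall fun x => by ring_nf)
    unfold ent at hent
    -- The entropy becomes `M (t l' - l)` with `l t = cgf Z P (-t)` and `M = exp (l t)`; dividing by
    -- `M` gives the differential inequality.
    rw [hlog, ← hP, hmgf, ← hd] at hent
    have hc : Real.log (mgf Z P (-t)) = cgf Z P (-t) := rfl
    rw [hc] at hent
    refine le_of_mul_le_mul_right ?_ hM
    linarith
  · intro t ht0
    have hM : 0 < mgf Z P (-t) := mgf_pos (hexp (-t))
    have h1 : mgf Z P (-t) ≤ Real.exp (expRem t * V) := by
      have h2 := integral_exp_sum_le ν (hs 0) (hb 0) (h0 0) ht0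
      refine le_trans ?_ (h2.trans (Real.exp_le_exp.2
        (mul_le_mul_of_nonneg_left (hV 0) (expRem_nonneg t))))
      refine integral_mono (hexp (-t)) ?_ fun x => Real.exp_le_exp.2
        (mul_le_mul_of_nonpos_left (hmax x 0) (neg_nonpos.2 ht0))
      exact integrable_exp_mul_of_abs_le (measurable_sum_apply (hs 0)) (abs_sum_le (hb 0)) (-t)
    exact (Real.log_le_iff_le_exp hM).2 h1

/-! ### Optimisation of the exponential bound -/

/-- For `t < 1` this compares power series: `3 ^ k / k! ≤ 9 / 2` for `k ≥ 2`. The proof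
differentiates twice and ends with `exp (-3 x) ≥ 1 - 3 x`. -/
theorem expRem_three_mul_le {t : ℝ} (ht : 0 ≤ t) :
    2 * (1 - t) * expRem (3 * t) ≤ 9 * t ^ 2 := by
  have hG : ∀ x, 0 ≤ x → 0 ≤ 6 * x + 4 - 4 * Real.exp (3 * x) + 6 * (x * Real.exp (3 * x)) :=
    fun x hx => nonneg_of_hasDerivAt_nonneg
      (F := fun x => 6 * x + 4 - 4 * Real.exp (3 * x) + 6 * (x * Real.exp (3 * x)))
      (F' := fun x => 6 * 1 - 4 * (3 * Real.exp (3 * x))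
        + 6 * (1 * Real.exp (3 * x) + x * (3 * Real.exp (3 * x))))
      (fun x => ((((hasDerivAt_id x).const_mul 6).add_const 4).sub
        ((hasDerivAt_exp_const_mul 3 x).const_mul 4)).add
        (((hasDerivAt_id x).mul (hasDerivAt_exp_const_mul 3 x)).const_mul 6)) (by simp)
      (fun x _ => by
        have h1 := Real.add_one_le_exp (-(3 * x))
        have h2 := mul_le_mul_of_nonneg_right h1 (Real.exp_pos (3 * x)).le
        rw [← Real.exp_add] at h2
        simp only [neg_add_cancel, Real.exp_zero] at h2
        linarith) hx
  have h := nonneg_of_hasDerivAt_nonneg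
    (F := fun x => 9 * x ^ 2 - 2 * (1 - x) * expRem (3 * x))
    (F' := fun x => 9 * ((2 : ℕ) * x ^ (2 - 1)) - (2 * (-1) * expRem (3 * x)
      + 2 * (1 - x) * (3 * (Real.exp (3 * x) - 1))))
    (fun x => ((hasDerivAt_pow 2 x).const_mul 9).sub
      ((((hasDerivAt_id x).const_sub 1).const_mul 2).mul (hasDerivAt_expRem_const_mul 3 x)))
    (by simp [expRem_zero])
    (fun x hx => by
      have := hG x hx
      unfold expRem
      norm_num
      linarith) ht
  linarith

section

variable {p v x : ℝ}

/-- Optimization of the exponential bound giving Bennett's inequality. -/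
theorem le_bennettBound (hv : 0 ≤ v) (hx : 0 < x)
    (hp : ∀ t, 0 < t → p ≤ Real.exp (-t * x + v / 9 * expRem (3 * t))) :
    p ≤ bennettBound v x := by
  unfold bennettBound
  split_ifs with h0
  · subst h0
    -- With `v = 0` the bound is `exp (-t x)` for every `t > 0`; let `t` tend to infinity.
    refine ge_of_tendsto (f := fun t : ℝ => Real.exp (-t * x)) (x := Filter.atTop) ?_ ?_
    · refine Real.tendsto_exp_atBot.comp ?_
      simp only [neg_mul]
      exact Filter.tendsto_neg_atTop_atBot.comp (Filter.tendsto_id.atTop_mul_const hx)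
    · filter_upwards [Filter.eventually_gt_atTop 0] with t ht
      simpa using hp t ht
  · have hv0 : 0 < v := lt_of_le_of_ne hv (Ne.symm h0)
    have hu : 0 < 3 * x / v := by positivity
    have hlog : 0 < Real.log (1 + 3 * x / v) := Real.log_pos (by linarith)
    -- The minimiser solves `exp (3 t) = 1 + 3 x / v`.
    refine (hp (Real.log (1 + 3 * x / v) / 3) (by positivity)).trans (le_of_eq ?_)
    have h3 : 3 * (Real.log (1 + 3 * x / v) / 3) = Real.log (1 + 3 * x / v) := by ring
    unfold expRem bennettH
    rw [h3, Real.exp_log (by linarith)]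
    congr 1
    field_simp
    ring

/-- Optimization of the exponential bound giving the sub-gamma form. -/
theorem le_exp_subgamma (hv : 0 ≤ v) (hx : 0 < x)
    (hp : ∀ t, 0 < t → p ≤ Real.exp (-t * x + v / 9 * expRem (3 * t))) :
    p ≤ Real.exp (-(x ^ 2 / (v + Real.sqrt (v ^ 2 + 2 * v * x) + x))) := by
  rcases eq_or_lt_of_le hv with h0 | hv0
  · refine (le_bennettBound hv hx hp).trans ?_
    unfold bennettBound
    rw [if_pos h0.symm]
    exact (Real.exp_pos _).le
  · set r := Real.sqrt (v ^ 2 + 2 * v * x) with hr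
    have hr2 : r ^ 2 = v ^ 2 + 2 * v * x := Real.sq_sqrt (by positivity)
    have hrv : v < r := by
      rw [hr]
      exact Real.lt_sqrt_of_sq_lt (by nlinarith [mul_pos hv0 hx])
    have hr0 : 0 < r := hv0.trans hrv
    have hxr : x = (r ^ 2 - v ^ 2) / (2 * v) := by
      rw [hr2]
      field_simp
      ring
    -- The exact minimiser of `-t x + v t ^ 2 / (2 (1 - t))`: its stationarity equation is `(1 - t)
    -- ^ (-2) = 1 + 2 x / v`.
    set t := 1 - v / r with ht
    have ht0 : 0 < t := by
      rw [ht, sub_pos, div_lt_one hr0]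
      exact hrv
    have h1t : 0 < 1 - t := by
      rw [ht, sub_sub_cancel]
      positivity
    refine (hp t ht0).trans (Real.exp_le_exp.2 ?_)
    have h1 : expRem (3 * t) ≤ 9 * t ^ 2 / (2 * (1 - t)) := by
      rw [le_div_iff₀ (by positivity)]
      linarith [expRem_three_mul_le ht0.le]
    have h2 := mul_le_mul_of_nonneg_left h1 (by positivity : 0 ≤ v / 9)
    have h3 : -t * x + v / 9 * (9 * t ^ 2 / (2 * (1 - t))) = -(x ^ 2 / (v + r + x)) := by
      have h4 : v + r + x = (r + v) ^ 2 / (2 * v) := by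
        rw [hxr]
        field_simp
        ring
      have h5 : 1 - t = v / r := by rw [ht]; ring
      rw [h4, h5, hxr, ht]
      field_simp
      ring
    linarith

theorem exp_subgamma_le (hv : 0 ≤ v) (hx : 0 < x) :
    Real.exp (-(x ^ 2 / (v + Real.sqrt (v ^ 2 + 2 * v * x) + x)))
      ≤ Real.exp (-(x ^ 2 / (2 * v + 2 * x))) := by
  have h1 : Real.sqrt (v ^ 2 + 2 * v * x) ≤ v + x :=
    Real.sqrt_le_iff.2 ⟨by positivity, by nlinarith [sq_nonneg x]⟩
  have h2 := Real.sqrt_nonneg (v ^ 2 + 2 * v * x)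
  refine Real.exp_le_exp.2 (neg_le_neg ?_)
  exact div_le_div_of_nonneg_left (sq_nonneg x) (by linarith) (by linarith)

end

/-! ### From finite maxima to countable suprema -/

section

variable {Ω E : Type*} [MeasurableSpace Ω] [MeasurableSpace E] {n : ℕ} {μ : Measure Ω}
  [IsProbabilityMeasure μ] {X : Fin n → Ω → E}

theorem measurable_partialSum (hX : ∀ k, Measurable (X k)) {s : E → Fin n → ℝ}
    (hs : Measurable s) : Measurable (partialSum X s) :=
  (measurable_sum_apply hs).comp (measurable_pi_lambda _ hX)

theorem variance_partialSum (hX : ∀ k, Measurable (X k)) (hindep : iIndepFun X μ)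
    {s : E → Fin n → ℝ} (hs : Measurable s) (hb : ∀ y k, |s y k| ≤ 1)
    (h0 : ∀ k, ∫ ω, s (X k ω) k ∂μ = 0) :
    variance (partialSum X s) μ = ∑ k, ∫ y, s y k ^ 2 ∂(μ.map (X k)) := by
  have hsk : ∀ k, Measurable fun y => s y k := fun k => (measurable_pi_apply k).comp hs
  have hm : ∀ k, Measurable fun ω => s (X k ω) k := fun k => (hsk k).comp (hX k)
  have hsum : partialSum X s = ∑ k, fun ω => s (X k ω) k := by
    ext ω
    simp [partialSum]
  rw [hsum, IndepFun.variance_sum]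
  · refine Finset.sum_congr rfl fun k _ => ?_
    rw [variance_of_integral_eq_zero (hm k).aemeasurable (h0 k),
      integral_map (hX k).aemeasurable ((hsk k).pow_const 2).aestronglyMeasurable]
  · exact fun k _ => MemLp.of_bound (hm k).aestronglyMeasurable 1
      (Filter.Eventually.of_forall fun ω => hb (X k ω) k)
  · intro i _ j _ hij
    exact (hindep.indepFun hij).comp (hsk i) (hsk j)

/-- The left-tail Laplace bound for finitely many sums of independent variables. -/
theorem exists_cgf_max_le_target (hX : ∀ k, Measurable (X k)) (hindep : iIndepFun X μ) {m : ℕ}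
    {s : Fin (m + 1) → E → Fin n → ℝ} (hs : ∀ i, Measurable (s i))
    (hb : ∀ i y k, |s i y k| ≤ 1) (h0 : ∀ i k, ∫ ω, s i (X k ω) k ∂μ = 0)
    {V : ℝ} (hV : ∀ i, variance (partialSum X (s i)) μ ≤ V) :
    ∃ Z : Ω → ℝ, Measurable Z ∧ (∀ ω i, partialSum X (s i) ω ≤ Z ω) ∧
      (∀ ω, ∃ i, Z ω = partialSum X (s i) ω) ∧
      ∀ t, 0 < t → cgf Z μ (-t) ≤ target (∫ ω, Z ω ∂μ) V t := by
  obtain ⟨τ, hτm, hτ⟩ := exists_measurable_argmax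
    (S := fun i (x : Fin n → E) => ∑ k, s i (x k) k) fun i => measurable_sum_apply (hs i)
  set ν : Fin n → Measure E := fun k => μ.map (X k) with hν
  have hprob : ∀ k, IsProbabilityMeasure (ν k) := fun k =>
    Measure.isProbabilityMeasure_map (hX k).aemeasurable
  set Y : Ω → Fin n → E := fun ω k => X k ω with hY
  have hYm : Measurable Y := measurable_pi_lambda _ hX
  have hmap : μ.map Y = Measure.pi ν :=
    (iIndepFun_iff_map_fun_eq_pi_map fun k => (hX k).aemeasurable).1 hindep
  set Z : (Fin n → E) → ℝ := fun x => ∑ k, s (τ x) (x k) k with hZ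
  have hZm : Measurable Z := Finset.measurable_sum _ fun k _ =>
    (measurable_from_prod_countable_right (f := fun p : Fin (m + 1) × E => s p.1 p.2 k)
      fun i => (measurable_pi_apply k).comp (hs i)).comp (hτm.prodMk (measurable_pi_apply k))
  refine ⟨fun ω => Z (Y ω), hZm.comp hYm, fun ω i => hτ (Y ω) i, fun ω => ⟨τ (Y ω), rfl⟩,
    fun t ht => ?_⟩
  have h := cgf_max_le_target ν hs hb
    (fun i k => by
      rw [← h0 i k]
      exact integral_map (hX k).aemeasurable
        ((measurable_pi_apply k).comp (hs i)).aestronglyMeasurable)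
    (fun i => (variance_partialSum hX hindep (hs i) (hb i) (h0 i)).symm.trans_le (hV i))
    hτm (fun x => rfl) hτ ht
  have h1 : ∫ x, Z x ∂(Measure.pi ν) = ∫ ω, Z (Y ω) ∂μ := by
    rw [← hmap]
    exact integral_map hYm.aemeasurable hZm.aestronglyMeasurable
  have h2 : cgf Z (Measure.pi ν) (-t) = cgf (fun ω => Z (Y ω)) μ (-t) := by
    unfold cgf mgf
    rw [← hmap]
    exact congrArg Real.log (integral_map hYm.aemeasurable
      (hZm.const_mul _).exp.aestronglyMeasurable)
  rw [← h1, ← h2]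
  exact h

/-- The supremum of a countable family of centered sums is measurable and bounded, its mean
and maximal variance are nonnegative, and its log-Laplace transform obeys the left-tail bound. -/
theorem measurable_sup_and_cgf_le_target (hX : ∀ k, Measurable (X k)) (hindep : iIndepFun X μ)
    {S : Set (E → Fin n → ℝ)} (hScount : S.Countable) (hSne : S.Nonempty)
    (hs : ∀ s ∈ S, Measurable s) (hb : ∀ s ∈ S, ∀ y k, |s y k| ≤ 1)
    (h0 : ∀ s ∈ S, ∀ k, ∫ ω, s (X k ω) k ∂μ = 0) :
    Measurable (supProcess X S) ∧ (∀ ω, abs (supProcess X S ω) ≤ n) ∧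
      0 ≤ ∫ ω, supProcess X S ω ∂μ ∧ 0 ≤ maxVariance μ X S ∧
      ∀ t, 0 < t → cgf (supProcess X S) μ (-t)
        ≤ target (∫ ω, supProcess X S ω ∂μ) (maxVariance μ X S) t := by
  obtain ⟨f, rfl⟩ := hScount.exists_eq_range hSne
  have hf : ∀ i, f i ∈ Set.range f := Set.mem_range_self
  have : Nonempty (Set.range f) := ⟨⟨f 0, hf 0⟩⟩
  have hSb : ∀ i ω, |partialSum X (f i) ω| ≤ n := fun i ω =>
    abs_sum_le (hb _ (hf i)) fun k => X k ω
  -- Boundedness, here and for the variances, is essential: a real supremum of an unbounded family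
  -- defaults to `0`.
  have hbdd : ∀ ω, BddAbove (Set.range fun s : Set.range f => partialSum X s.1 ω) := fun ω => by
    refine ⟨n, ?_⟩
    rintro _ ⟨⟨_, i, rfl⟩, rfl⟩
    exact (abs_le.1 (hSb i ω)).2
  have hle : ∀ i ω, partialSum X (f i) ω ≤ supProcess X (Set.range f) ω := fun i ω =>
    le_ciSup (hbdd ω) ⟨f i, hf i⟩
  have hvbdd : BddAbove (Set.range fun s : Set.range f => variance (partialSum X s.1) μ) := by
    refine ⟨n, ?_⟩
    rintro _ ⟨⟨_, i, rfl⟩, rfl⟩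
    dsimp only
    rw [variance_partialSum hX hindep (hs _ (hf i)) (hb _ (hf i)) (h0 _ (hf i))]
    have : ∀ k, IsProbabilityMeasure (μ.map (X k)) := fun k =>
      Measure.isProbabilityMeasure_map (hX k).aemeasurable
    simpa using Finset.sum_le_sum fun k (_ : k ∈ Finset.univ) =>
      integral_sq_le_one (ν := μ.map (X k)) ((measurable_pi_apply k).comp (hs _ (hf i)))
        fun y => hb _ (hf i) y k
  have hvle : ∀ i, variance (partialSum X (f i)) μ ≤ maxVariance μ X (Set.range f) := fun i =>
    le_ciSup hvbdd ⟨f i, hf i⟩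
  -- `Z m` is the maximum over the indices `0, ..., m`; the full maximal variance serves for all `m`
  -- at once.
  have hfin := fun m : ℕ => exists_cgf_max_le_target hX hindep (m := m)
    (s := fun i => f i) (fun i => hs _ (hf i)) (fun i => hb _ (hf i)) (fun i => h0 _ (hf i))
    (fun i => hvle i)
  choose Z hZm hZge hZeq hZcgf using hfin
  have hZb : ∀ m ω, |Z m ω| ≤ n := fun m ω => by
    obtain ⟨i, hi⟩ := hZeq m ω
    rw [hi]
    exact hSb i ω
  have hlim : ∀ ω, Filter.Tendsto (fun m => Z m ω) Filter.atTop
      (nhds (supProcess X (Set.range f) ω)) := fun ω => by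
    refine tendsto_order.2 ⟨fun a ha => ?_, fun a ha => ?_⟩
    · obtain ⟨⟨_, i, rfl⟩, hi⟩ := exists_lt_of_lt_ciSup ha
      filter_upwards [Filter.eventually_ge_atTop i] with m hm
      exact hi.trans_le (hZge m ω ⟨i, Nat.lt_succ_of_le hm⟩)
    · refine Filter.Eventually.of_forall fun m => ?_
      obtain ⟨i, hi⟩ := hZeq m ω
      rw [hi]
      exact (hle i ω).trans_lt ha
  have hm : Measurable (supProcess X (Set.range f)) :=
    measurable_of_tendsto_metrizable hZm (tendsto_pi_nhds.2 hlim)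
  have hsb : ∀ ω, abs (supProcess X (Set.range f) ω) ≤ n := fun ω =>
    le_of_tendsto (hlim ω).abs (Filter.Eventually.of_forall fun m => hZb m ω)
  have hint : Filter.Tendsto (fun m => ∫ ω, Z m ω ∂μ) Filter.atTop
      (nhds (∫ ω, supProcess X (Set.range f) ω ∂μ)) :=
    tendsto_integral_of_dominated_convergence (fun _ => (n : ℝ))
      (fun m => (hZm m).aestronglyMeasurable) (integrable_const _)
      (fun m => Filter.Eventually.of_forall fun ω => hZb m ω)
      (Filter.Eventually.of_forall hlim)
  refine ⟨hm, hsb, ?_, (variance_nonneg _ _).trans (hvle 0), fun t ht => ?_⟩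
  · have h1 : ∫ ω, partialSum X (f 0) ω ∂μ = 0 := by
      unfold partialSum
      rw [integral_finsetSum]
      · exact Finset.sum_eq_zero fun k _ => h0 _ (hf 0) k
      · exact fun k _ => integrable_of_abs_le
          (((measurable_pi_apply k).comp (hs _ (hf 0))).comp (hX k))
          fun ω => hb _ (hf 0) (X k ω) k
    rw [← h1]
    exact integral_mono (integrable_of_abs_le (measurable_partialSum hX (hs _ (hf 0))) (hSb 0))
      (integrable_of_abs_le hm hsb) fun ω => hle 0 ω
  · have hmgf : Filter.Tendsto (fun m => mgf (Z m) μ (-t)) Filter.atTop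
        (nhds (mgf (supProcess X (Set.range f)) μ (-t))) := by
      refine tendsto_integral_of_dominated_convergence (fun _ => Real.exp (t * n))
        (fun m => ((hZm m).const_mul _).exp.aestronglyMeasurable) (integrable_const _)
        (fun m => Filter.Eventually.of_forall fun ω => ?_)
        (Filter.Eventually.of_forall fun ω => ((hlim ω).const_mul _).rexp)
      rw [Real.norm_eq_abs, Real.abs_exp]
      refine Real.exp_le_exp.2 ?_
      have := mul_le_mul_of_nonneg_left (neg_le.1 (abs_le.1 (hZb m ω)).1) ht.le
      linarith
    have hpos : 0 < mgf (supProcess X (Set.range f)) μ (-t) :=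
      mgf_pos (integrable_exp_mul_of_abs_le hm hsb (-t))
    have hcgf : Filter.Tendsto (fun m => cgf (Z m) μ (-t)) Filter.atTop
        (nhds (cgf (supProcess X (Set.range f)) μ (-t))) := hmgf.log hpos.ne'
    refine le_of_tendsto_of_tendsto' hcgf ?_ fun m => hZcgf m t ht
    unfold target
    exact (hint.const_mul _).add ((((hint.const_mul 2).add_const _).div_const 9).mul_const _)

end

end KleinRio

/-! ### The theorem -/

theorem theorem1p2 {Ω : Type*} [MeasurableSpace Ω] (μ : Measure Ω) [IsProbabilityMeasure μ]
    {E : Type*} [TopologicalSpace E] [PolishSpace E] [MeasurableSpace E] [BorelSpace E]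
    (n : ℕ) (X : Fin n → Ω → E) (hX : ∀ k, Measurable (X k)) (hindep : iIndepFun X μ)
    (S : Set (E → Fin n → ℝ)) (hScount : S.Countable) (hSne : S.Nonempty)
    (hSmeas : ∀ s ∈ S, Measurable s)
    (hSbdd : ∀ s ∈ S, ∀ y k, s y k ∈ Set.Icc (-1 : ℝ) 1)
    (hScent : ∀ s ∈ S, ∀ k, ∫ ω, s (X k ω) k ∂μ = 0)
    (Z : Ω → ℝ) (hZ : Z = KleinRio.supProcess X S)
    (v : ℝ) (hv : v = KleinRio.varianceFactor μ X S) :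
    (∀ t : ℝ, 0 < t →
      cgf Z μ (-t) ≤ -t * (∫ ω, Z ω ∂μ) + v / 9 * (Real.exp (3 * t) - 3 * t - 1)) ∧
    (∀ x : ℝ, 0 < x →
      μ.real {ω | Z ω ≤ (∫ ω', Z ω' ∂μ) - x} ≤ KleinRio.bennettBound v x) ∧
    (∀ x : ℝ, 0 < x →
      μ.real {ω | Z ω ≤ (∫ ω', Z ω' ∂μ) - x} ≤
          Real.exp (-(x ^ 2 / (v + Real.sqrt (v ^ 2 + 2 * v * x) + x))) ∧
        Real.exp (-(x ^ 2 / (v + Real.sqrt (v ^ 2 + 2 * v * x) + x))) ≤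
          Real.exp (-(x ^ 2 / (2 * v + 2 * x)))) := by
  subst hZ hv
  have hb : ∀ s ∈ S, ∀ y k, |s y k| ≤ 1 := fun s hs y k => abs_le.2 (hSbdd s hs y k)
  obtain ⟨hm, hZb, hz, hV, hcgf⟩ :=
    KleinRio.measurable_sup_and_cgf_le_target hX hindep hScount hSne hSmeas hb hScent
  have hv : 0 ≤ KleinRio.varianceFactor μ X S := by
    unfold KleinRio.varianceFactor
    positivity
  have htail : ∀ x t : ℝ, 0 < t →
      μ.real {ω | KleinRio.supProcess X S ω ≤ (∫ ω', KleinRio.supProcess X S ω' ∂μ) - x}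
        ≤ Real.exp (-t * x + KleinRio.varianceFactor μ X S / 9 * KleinRio.expRem (3 * t)) :=
    fun x t ht => by
      -- Chernoff's inequality at the parameter `-t`; the terms in the mean of `Z` cancel, leaving
      -- `-t x`.
      refine (measure_le_le_exp_cgf _ (by linarith : -t ≤ 0)
        (KleinRio.integrable_exp_mul_of_abs_le hm hZb (-t))).trans (Real.exp_le_exp.2 ?_)
      have h := hcgf t ht
      unfold KleinRio.target at h
      unfold KleinRio.varianceFactor
      linarith
  refine ⟨fun t ht => ?_, fun x hx => KleinRio.le_bennettBound hv hx (htail x),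
    fun x hx => ⟨KleinRio.le_exp_subgamma hv hx (htail x), KleinRio.exp_subgamma_le hv hx⟩⟩
  have h := hcgf t ht
  unfold KleinRio.target KleinRio.expRem at h
  exact h
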